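/- **Logic.** Formulas of $AB\bar B{\sim}$ are built from proposition letters (among them a special letter $\sim$) with $\neg$, $\vee$, $\langle A\rangle$, $\langle B\rangle$, $\langle\bar B\rangle$, and are evaluated on the closed intervals $[x,y]$, $x\le y$, of a linear order $\mathbb D$ under a valuation $\mathcal V$ of the intervals by sets of letters: $[x,y]\,A\,[x',y']$ iff $y=x'$; $[x,y]\,B\,[x',y']$ iff $x=x'$ and $y'<y$; $[x,y]\,\bar B\,[x',y']$ iff $x=x'$ and $y<y'$. In an interval structure $\sim$ is an equivalence relation: there is an equivalence relation on the points such that $\sim\in\mathcal V([x,y])$ iff $x\sim y$. Fix a formula $\varphi$. Its closure $Cl(\varphi)$ consists of the subformulas of $\varphi$ ($\sim$ is always counted among them) and their negations, where $\neg\neg\psi$ is identified with $\psi$. The extended closure $Cl^+(\varphi)$ adds $\langle R\rangle\psi$ and $[R]\psi=\neg\langle R\rangle\neg\psi$ for $\psi\in Cl(\varphi)$, $R\in\{A,B,\bar B\}$. The temporal requests are the formulas $\langle R\rangle\psi\in Cl^+(\varphi)$, and $\Sigma^T$ is the set of letters of $\varphi$ (with $\sim$) and temporal requests. Fix $\Sigma^T_\Box\subseteq\Sigma^T$,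 the part controlled by Spoiler. **Runs.** An admissible run is a finite or infinite sequence $\rho=(I_0,\sigma_0)(I_1,\sigma_1)\dots$ with $I_i=[x_i,y_i]$ an interval of $\mathbb N$ such that: $I_0=[0,0]$; for each even $i$, $I_i=I_{i+1}$, $\sigma_i\subseteq\Sigma^T_\Box$ (Spoiler's move), $\sigma_{i+1}\subseteq\Sigma^T\setminus\Sigma^T_\Box$ (Duplicator's move), and $I_j\ne I_i$ for $j\ne i,i+1$; if $y_{i+1}\neq y_i$, then $y_{i+1}=y_i+1$ and every $[x,y]$ with $y<y_{i+1}$ is some $I_j$ with $j<i+1$; if $\rho$ is infinite, it visits every interval of $\mathbb N$, and if it is finite, then there is $m>0$ such that it has length $m(m+1)$ and visits every interval of $\{0,\dots,m-1\}$. A finite admissible run induces $\mathbf M_\rho=(\{0<\dots<m-1\},\mathcal V)$, where $\mathcal V([x,y])$ is the set of letters in the two sets that $\rho$ puts on $[x,y]$. It is successful if $\mathbf M_\rho$ is an interval structure, $\mathbf M_\rho,[0,0]\models\varphi$, and each temporal request is true on an interval of $\mathbf M_\rho$ iff it is in one of the two sets that $\rho$ puts on that interval. A Spoiler sequence is the sequence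 $\rho[0]\rho[2]\rho[4]\dots$ of an infinite admissible run $\rho$. **Response trees.** A $\Sigma^T_\Box$-response tree for $\varphi$ is a finite rooted tree $\mathcal T=(V,E,\mathcal L_V,\mathcal L_E)$ in which each node has a label $\mathcal L_V(v)\subseteq\Sigma^T\setminus\Sigma^T_\Box$ and each edge a label $\mathcal L_E(v,v')=(I,\sigma)$ with $I$ an interval of $\mathbb N$ and $\sigma\subseteq\Sigma^T_\Box$, different edges out of the same node having different labels, such that - for each root-to-leaf path $(v_0,v_1)(v_1,v_2)\dots(v_{k-1},v_k)$, with $\mathcal L_E(v_i,v_{i+1})=(I_i,\sigma_i)$, the sequence $(I_0,\sigma_0)(I_0,\mathcal L_V(v_1))\dots(I_{k-1},\sigma_{k-1})(I_{k-1},\mathcal L_V(v_k))$ is a successful finite admissible run (these sequences are the runs of $\mathcal T$); - each Spoiler sequence has a finite prefix that is the sequence of edge labels of a root-to-leaf path. **Minimality.** Let $\mathbf M$ be a finite interval structure with domain $D$. For $x\le y$ let $\tau(x,y)$ be the type of $[x,y]$, i.e. the set of all $\psi\in Cl^+(\varphi)$ with $\mathbf M,[x,y]\models\psi$, and for $x>y$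 let $\tau(x,y)=\emptyset$; this is the compass structure $\mathcal G_{\mathbf M}$. For $x\le y$, let $M(x,y)$ be the multiset of the types $\tau(x',y)$, over all $x'\le y$ with $x'\sim x$. Let $\mathcal M(y)$ be the multiset in which each multiset $M$ occurs as often as there are classes $[x]_\sim$ with $x\le y$ and $M(x,y)=M$. For two such collections, $\mathcal M\le\mathcal M'$ means that there is an injective multiset function from $\mathcal M$ to $\mathcal M'$ (a multiset of pairs whose first projection is $\mathcal M$ and whose second projection is contained in $\mathcal M'$) all of whose pairs $(M,M')$ satisfy $M\subseteq M'$. $\mathcal G_{\mathbf M}$ is minimal if there are no $y<y'$ in $D$ with $\mathcal M(y)\le\mathcal M(y')$. A response tree is minimal if $\mathcal G_{\mathbf M_\rho}$ is minimal for each of its runs $\rho$. **Lemma.** Let $\varphi$ be an $AB\bar B{\sim}$ formula and $\Sigma^T_\Box\subseteq\Sigma^T$. If there exists a $\Sigma^T_\Box$-response tree for $\varphi$, then there exists a minimal $\Sigma^T_\Box$-response tree for $\varphi$. -/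

import Mathlib

namespace IntervalSynthesis

/-- Proposition letters: the special letter `∼` and the ordinary letters of `P`. -/
inductive Letter (P : Type*) where
  | sim : Letter P
  | var : P → Letter P

/-- Allen's relations meets, begun by, begins. -/
inductive Allen where
  | A : Allen
  | B : Allen
  | Bbar : Allen

/-- Allen's relations between closed intervals `[x, y]`, `x ≤ y`, of a linear order. -/
def Allen.Holds {D : Type*} [LinearOrder D] :
    Allen → NonemptyInterval D → NonemptyInterval D → Prop
  | .A, I, J => I.snd = J.fst
  | .B, I, J => I.fst = J.fst ∧ J.snd < I.snd
  | .Bbar, I, J => I.fst = J.fst ∧ I.snd < J.snd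

/-- Formulas of the logic with the modalities `⟨A⟩`, `⟨B⟩`, `⟨B̄⟩` and the letter `∼`. -/
inductive Formula (P : Type*) where
  | letter : Letter P → Formula P
  | neg : Formula P → Formula P
  | or : Formula P → Formula P → Formula P
  | dia : Allen → Formula P → Formula P

/-- The letter `∼` as a formula. -/
def Formula.sim {P : Type*} : Formula P := .letter .sim

/-- Satisfaction `(D, val), I ⊨ ψ`. -/
def Sat {P D : Type*} [LinearOrder D] (val : NonemptyInterval D → Set (Letter P)) :
    Formula P → NonemptyInterval D → Prop
  | .letter a, I => a ∈ val I
  | .neg ψ, I => ¬ Sat val ψ I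
  | .or ψ χ, I => Sat val ψ I ∨ Sat val χ I
  | .dia R ψ, I => ∃ J, R.Holds I J ∧ Sat val ψ J

/-- `val` interprets `∼` as an equivalence relation: there is an equivalence relation on the
points such that `∼` labels `[x, y]` exactly when `x` and `y` are equivalent. -/
def SimIsEquivalence {P D : Type*} [LinearOrder D]
    (val : NonemptyInterval D → Set (Letter P)) : Prop :=
  ∃ r : Setoid D, ∀ I : NonemptyInterval D, Letter.sim ∈ val I ↔ r I.fst I.snd

/-- Subformulas of a formula (including the formula itself). -/
def Formula.subformulas {P : Type*} : Formula P → Set (Formula P)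
  | .letter a => {.letter a}
  | .neg ψ => insert (.neg ψ) ψ.subformulas
  | .or ψ χ => insert (.or ψ χ) (ψ.subformulas ∪ χ.subformulas)
  | .dia R ψ => insert (.dia R ψ) ψ.subformulas

/-- Negation, where `¬¬ψ` is identified with `ψ`. -/
def Formula.compl {P : Type*} : Formula P → Formula P
  | .neg ψ => ψ
  | ψ => .neg ψ

/-- The closure of `φ`: its subformulas and their negations. The letter `∼` always belongs to
the alphabet, so it is counted among the subformulas even if it does not occur in `φ`. -/
def closure {P : Type*} (φ : Formula P) : Set (Formula P) :=
  {ψ | ∃ χ ∈ insert Formula.sim φ.subformulas, ψ = χ ∨ ψ = χ.compl}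

/-- The extended closure: the closure, and all `⟨R⟩ψ` and `[R]ψ = ¬⟨R⟩¬ψ` for `ψ` in the
closure. -/
def extClosure {P : Type*} (φ : Formula P) : Set (Formula P) :=
  closure φ ∪ {χ | ∃ R, ∃ ψ ∈ closure φ, χ = .dia R ψ ∨ χ = .neg (.dia R ψ.compl)}

/-- The temporal requests: the formulas `⟨R⟩ψ` in the extended closure. -/
def temporalRequests {P : Type*} (φ : Formula P) : Set (Formula P) :=
  {χ ∈ extClosure φ | ∃ R ψ, χ = .dia R ψ}

/-- The proposition letters in play: `∼` and the letters occurring in `φ`, as formulas. -/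
def letters {P : Type*} (φ : Formula P) : Set (Formula P) :=
  {χ ∈ insert Formula.sim φ.subformulas | ∃ a, χ = .letter a}

/-- `Σ^T`: proposition letters and temporal requests. -/
def sigmaT {P : Type*} (φ : Formula P) : Set (Formula P) :=
  letters φ ∪ temporalRequests φ

/-- One step of a run: an interval of natural numbers with a set of formulas. -/
abbrev Move (P : Type*) := NonemptyInterval ℕ × Set (Formula P)

/-- The rules that finite and infinite runs have in common, for a (finite or infinite) sequence
`r`, where `r i = none` means that the sequence has no entry with index `i`. The set `S` holds the
letters and requests of Spoiler. -/
structure RunRules {P : Type*} (φ : Formula P) (S : Set (Formula P))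
    (r : ℕ → Option (Move P)) : Prop where
  /-- The first interval is `[0, 0]`. -/
  start : ∀ s, r 0 = some s → s.1.fst = 0 ∧ s.1.snd = 0
  /-- Spoiler moves at even indices, and Duplicator answers on the same interval. -/
  answer : ∀ i s t, Even i → r i = some s → r (i + 1) = some t →
    s.1 = t.1 ∧ s.2 ⊆ S ∧ t.2 ⊆ sigmaT φ \ S
  /-- No interval is chosen twice. -/
  once : ∀ i j s t, Even i → j ≠ i → j ≠ i + 1 → r i = some s → r j = some t → s.1 ≠ t.1
  /-- Right endpoints grow by steps of one, and only after all intervals with a smaller right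
  endpoint have been visited. -/
  step : ∀ i s t, r i = some s → r (i + 1) = some t → t.1.snd ≠ s.1.snd →
    t.1.snd = s.1.snd + 1 ∧
      ∀ I : NonemptyInterval ℕ, I.snd < t.1.snd → ∃ j < i + 1, ∃ u, r j = some u ∧ u.1 = I

/-- Finite admissible runs over the points `0, …, m - 1`. There are `m (m + 1) / 2` intervals and
each of them takes two moves. -/
structure IsFiniteRun {P : Type*} (φ : Formula P) (S : Set (Formula P)) (m : ℕ)
    (ρ : List (Move P)) : Prop where
  pos : 0 < m
  length_eq : ρ.length = m * (m + 1)
  covers : ∀ I : NonemptyInterval ℕ, I.snd < m → ∃ s ∈ ρ, s.1 = I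
  rules : RunRules φ S (fun i => ρ[i]?)

/-- Infinite admissible runs. -/
structure IsInfiniteRun {P : Type*} (φ : Formula P) (S : Set (Formula P))
    (ρ : ℕ → Move P) : Prop where
  covers : ∀ I : NonemptyInterval ℕ, ∃ i, (ρ i).1 = I
  rules : RunRules φ S (fun i => some (ρ i))

/-- The sequences of Spoiler's moves (the even positions) of infinite admissible runs. -/
def IsSpoilerRun {P : Type*} (φ : Formula P) (S : Set (Formula P)) (s : ℕ → Move P) : Prop :=
  ∃ ρ, IsInfiniteRun φ S ρ ∧ ∀ i, s i = ρ (2 * i)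

/-- An interval of the prefix `{0, …, m - 1}` as an interval of natural numbers. -/
def natInterval {m : ℕ} (I : NonemptyInterval (Fin m)) : NonemptyInterval ℕ :=
  ⟨(I.fst.val, I.snd.val), I.fst_le_snd⟩

/-- Everything that the two players put on the interval `I` in the run `ρ`. -/
def runLabel {P : Type*} (ρ : List (Move P)) (I : NonemptyInterval ℕ) : Set (Formula P) :=
  {ψ | ∃ s ∈ ρ, s.1 = I ∧ ψ ∈ s.2}

/-- The valuation, over the points `0, …, m - 1`, of the interval structure induced by a run. -/
def inducedVal {P : Type*} (ρ : List (Move P)) (m : ℕ) :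
    NonemptyInterval (Fin m) → Set (Letter P) :=
  fun I => {a | Formula.letter a ∈ runLabel ρ (natInterval I)}

/-- Successful finite admissible runs: the induced structure (in which `∼` has to be an
equivalence relation) satisfies `φ` on `[0, 0]`, and each temporal request labels exactly the
intervals where it is true. -/
def IsSuccessful {P : Type*} (φ : Formula P) (S : Set (Formula P)) (ρ : List (Move P)) : Prop :=
  ∃ m, IsFiniteRun φ S m ρ ∧
    SimIsEquivalence (inducedVal ρ m) ∧
    (∀ I : NonemptyInterval (Fin m), I.fst.val = 0 → I.snd.val = 0 → Sat (inducedVal ρ m) φ I) ∧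
    ∀ I : NonemptyInterval (Fin m), ∀ ψ ∈ temporalRequests φ,
      Sat (inducedVal ρ m) ψ I ↔ ψ ∈ runLabel ρ (natInterval I)

/-- Finite rooted trees with labelled nodes and edges. The value of `edgeLabel` is meaningful on
edges only. -/
structure LabelledTree (P : Type*) where
  V : Type
  finite : Finite V
  root : V
  E : V → V → Prop
  not_edge_root : ∀ v, ¬ E v root
  parent_unique : ∀ u u' v, E u v → E u' v → u = u'
  reachable : ∀ v, Relation.ReflTransGen E root v
  nodeLabel : V → Set (Formula P)
  edgeLabel : V → V → Move P

namespace LabelledTree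

variable {P : Type*} (T : LabelledTree P)

/-- `root, v₁, …, vₖ` is a path that ends in a leaf. -/
def IsRootToLeaf (vs : List T.V) : Prop :=
  List.IsChain T.E (T.root :: vs) ∧
    ∀ w, ¬ T.E ((T.root :: vs).getLast (List.cons_ne_nil _ _)) w

/-- The labels of the edges of the path that starts in a node and goes on through a list. -/
def edgeLabels : T.V → List T.V → List (Move P)
  | _, [] => []
  | u, v :: vs => T.edgeLabel u v :: edgeLabels v vs

/-- The run along a path: each edge contributes Spoiler's move (the label of the edge), then
Duplicator's answer on the same interval (the label of the target of the edge). -/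
def pathRun : T.V → List T.V → List (Move P)
  | _, [] => []
  | u, v :: vs =>
      T.edgeLabel u v :: ((T.edgeLabel u v).1, T.nodeLabel v) :: pathRun v vs

/-- The runs of the root-to-leaf paths. -/
def runs : Set (List (Move P)) :=
  {ρ | ∃ vs, T.IsRootToLeaf vs ∧ ρ = T.pathRun T.root vs}

/-- Response trees for `φ`, where `S` holds the letters and requests of Spoiler. -/
structure IsResponseTree (φ : Formula P) (S : Set (Formula P)) : Prop where
  nodeLabel_subset : ∀ v, T.nodeLabel v ⊆ sigmaT φ \ S
  edgeLabel_subset : ∀ u v, T.E u v → (T.edgeLabel u v).2 ⊆ S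
  /-- Different edges out of a node carry different moves of Spoiler, so that the tree encodes
  a strategy of Duplicator. -/
  deterministic : ∀ u v w, T.E u v → T.E u w → T.edgeLabel u v = T.edgeLabel u w → v = w
  successful : ∀ ρ ∈ T.runs, IsSuccessful φ S ρ
  /-- Every infinite sequence of moves of Spoiler is answered along some root-to-leaf path. -/
  complete : ∀ s, IsSpoilerRun φ S s → ∃ vs, T.IsRootToLeaf vs ∧
    T.edgeLabels T.root vs = (List.range vs.length).map s

end LabelledTree

/-- The `φ`-type of an interval: the formulas of the extended closure that it satisfies. -/
def intervalType {P D : Type*} [LinearOrder D] (val : NonemptyInterval D → Set (Letter P))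
    (φ : Formula P) (I : NonemptyInterval D) : Set (Formula P) :=
  {ψ ∈ extClosure φ | Sat val ψ I}

open Classical in
/-- The labelling of the compass structure of an interval structure: the point `(x, y)` carries
the type of `[x, y]` if `x ≤ y`, and the dummy atom `∅` otherwise. -/
noncomputable def compass {P D : Type*} [LinearOrder D]
    (val : NonemptyInterval D → Set (Letter P)) (φ : Formula P) (x y : D) : Set (Formula P) :=
  if h : x ≤ y then intervalType val φ ⟨(x, y), h⟩ else ∅

open Classical in
/-- The class `[x]_∼` in a compass structure. The dummy atom is empty, so at most the disjunct
with ordered arguments can hold. -/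
noncomputable def simClass {P D : Type*} [Fintype D] (τ : D → D → Set (Formula P)) (x : D) :
    Finset D :=
  Finset.univ.filter fun x' => Formula.sim ∈ τ x' x ∨ Formula.sim ∈ τ x x'

open Classical in
/-- The multiset of the labels of the points `(x', y)`, with `x' ≤ y` in the class `c`. For
`c = [x]_∼` this is the multiset `M(x, y)`. -/
noncomputable def classAtoms {P D : Type*} [LinearOrder D] (τ : D → D → Set (Formula P))
    (c : Finset D) (y : D) : Multiset (Set (Formula P)) :=
  (c.filter fun x' => x' ≤ y).val.map fun x' => τ x' y

open Classical in
/-- The collection `𝓜(y)`: the multiset of the `M(x, y)`, one copy for each class `[x]_∼` that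
contains a point `x ≤ y`. -/
noncomputable def collection {P D : Type*} [LinearOrder D] [Fintype D]
    (τ : D → D → Set (Formula P)) (y : D) : Multiset (Multiset (Set (Formula P))) :=
  ((Finset.univ.filter fun x => x ≤ y).image (simClass τ)).val.map fun c => classAtoms τ c y

/-- The order on collections: there is an injective multiset function `g` from `M` to `N` that
sends each multiset to a multiset which contains it. -/
def CollectionLE {α : Type*} (M N : Multiset (Multiset α)) : Prop :=
  ∃ g : Multiset (Multiset α × Multiset α),
    g.map Prod.fst = M ∧ g.map Prod.snd ≤ N ∧ ∀ p ∈ g, p.1 ≤ p.2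

/-- Minimal compass structures. -/
def IsMinimalCompass {P D : Type*} [LinearOrder D] [Fintype D]
    (τ : D → D → Set (Formula P)) : Prop :=
  ∀ y y' : D, y < y' → ¬ CollectionLE (collection τ y) (collection τ y')

/-- Minimal trees: the compass structure of each of the runs is minimal. The number `m` of points
of a run is determined by its length `m (m + 1)`. -/
def LabelledTree.IsMinimal {P : Type*} (T : LabelledTree P) (φ : Formula P) : Prop :=
  ∀ ρ ∈ T.runs, ∀ m, ρ.length = m * (m + 1) → IsMinimalCompass (compass (inducedVal ρ m) φ)

end IntervalSynthesis

namespace IntervalSynthesis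

variable {P : Type*}

/-! A response tree is a bounded-depth winning strategy for Duplicator in a game on rounds, where
Spoiler may choose any unvisited interval once all lower rows are complete. The minimal tree is
obtained by letting Duplicator win as fast as possible. `value` is the least number of rounds in
which success can be forced, and an optimal strategy lowers it in each round
(`Follows.value_add_le`). The positions consistent with such a strategy form a finite tree whose
leaves are the successful positions, hence again a response tree.

Its runs are minimal for the following reason. Suppose `𝓜(y) ≤ 𝓜(y')` with `y < y'` in some run. The
comparison of collections unfolds to an injection of the points up to `y` into those up to `y'` that
carries row `y` into row `y'` and preserves and reflects `∼` (`exists_injOn_of_collectionLE`). Let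
`p₁` and `p₂` be positions of the run at which exactly the rows up to `y`, respectively `y'`, are
complete. From `p₁`, Duplicator can imitate a win from `p₂`: she keeps a shadow play beyond `p₂`,
translates Spoiler's intervals by `embed`, copies the answers, and fills the columns without a
counterpart by harmless extra rounds (`WinIn.of_simulates`). When the shadow play succeeds, so does
the real one, because cutting out the rows between `y` and `y'` keeps a structure coherent
(`Coherent.contract`). So the value at `p₁` is at most that at `p₂`, although it dropped strictly on
the way from `p₁` to `p₂`: a contradiction (`Follows.isMinimalCompass`). -/

/-! ### Closures, requests and the finite alphabet -/

theorem Formula.self_mem_subformulas (ψ : Formula P) : ψ ∈ ψ.subformulas := by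
  cases ψ <;> simp [Formula.subformulas]

theorem Formula.subformulas_trans {χ ψ φ : Formula P} (h' : ψ ∈ φ.subformulas)
    (h : χ ∈ ψ.subformulas) : χ ∈ φ.subformulas := by
  induction φ with
  | letter a =>
    simp only [Formula.subformulas, Set.mem_singleton_iff] at h'
    subst h'
    exact h
  | neg φ ih =>
    rcases h' with rfl | h'
    · exact h
    · exact Or.inr (ih h')
  | or φ₁ φ₂ ih₁ ih₂ =>
    rcases h' with rfl | h' | h'
    · exact h
    · exact Or.inr (Or.inl (ih₁ h'))
    · exact Or.inr (Or.inr (ih₂ h'))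
  | dia R φ ih =>
    rcases h' with rfl | h'
    · exact h
    · exact Or.inr (ih h')

theorem self_mem_closure (φ : Formula P) : φ ∈ closure φ :=
  ⟨φ, Or.inr φ.self_mem_subformulas, Or.inl rfl⟩

theorem sim_mem_closure (φ : Formula P) : Formula.sim ∈ closure φ :=
  ⟨Formula.sim, Or.inl rfl, Or.inl rfl⟩

theorem subformulas_subset_closure (φ : Formula P) : φ.subformulas ⊆ closure φ :=
  fun χ h => ⟨χ, Or.inr h, Or.inl rfl⟩

/-- Taking complements either adds a negation or strips one, and what it strips was a subformula
already; so apart from `∼` the only new members of the closure are negations. -/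
theorem mem_subformulas_of_mem_closure {φ ψ : Formula P} (h : ψ ∈ closure φ)
    (hl : ψ ≠ Formula.sim) (hn : ∀ χ, ψ ≠ .neg χ) : ψ ∈ φ.subformulas := by
  obtain ⟨χ, hχ, rfl | rfl⟩ := h
  · exact hχ.resolve_left hl
  · cases χ with
    | neg χ =>
      rcases hχ with hχ | hχ
      · cases hχ
      · exact Formula.subformulas_trans hχ (Or.inr χ.self_mem_subformulas)
    | _ => exact absurd rfl (hn _)

theorem mem_closure_of_neg {φ ψ : Formula P} (h : Formula.neg ψ ∈ closure φ) :
    ψ ∈ closure φ := by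
  have sub : ∀ χ : Formula P, χ.neg ∈ insert Formula.sim φ.subformulas → χ ∈ φ.subformulas := by
    rintro χ (h | h)
    · cases h
    · exact Formula.subformulas_trans h (Or.inr χ.self_mem_subformulas)
  obtain ⟨χ, hχ, h | h⟩ := h
  · subst h
    exact subformulas_subset_closure φ (sub _ hχ)
  · cases χ with
    | neg χ =>
      simp only [Formula.compl] at h
      subst h
      exact subformulas_subset_closure φ
        (Formula.subformulas_trans (sub _ hχ) (Or.inr ψ.self_mem_subformulas))
    | _ =>
      simp only [Formula.compl, Formula.neg.injEq] at h
      subst h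
      exact ⟨_, hχ, Or.inl rfl⟩

theorem mem_closure_of_or {φ ψ χ : Formula P} (h : Formula.or ψ χ ∈ closure φ) :
    ψ ∈ closure φ ∧ χ ∈ closure φ := by
  have h' := mem_subformulas_of_mem_closure h (fun h => by cases h) (fun _ h => by cases h)
  exact ⟨subformulas_subset_closure φ
      (Formula.subformulas_trans h' (Or.inr (Or.inl ψ.self_mem_subformulas))),
    subformulas_subset_closure φ
      (Formula.subformulas_trans h' (Or.inr (Or.inr χ.self_mem_subformulas)))⟩

theorem mem_closure_of_dia {φ ψ : Formula P} {R : Allen} (h : Formula.dia R ψ ∈ closure φ) :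
    ψ ∈ closure φ := by
  have h' := mem_subformulas_of_mem_closure h (fun h => by cases h) (fun _ h => by cases h)
  exact subformulas_subset_closure φ
    (Formula.subformulas_trans h' (Or.inr ψ.self_mem_subformulas))

/-- The box formulas of the extended closure begin with `¬`, and a diamond in the closure has its
argument there as well; hence no further diamonds arise. -/
theorem mem_temporalRequests {φ χ : Formula P} :
    χ ∈ temporalRequests φ ↔ ∃ R, ∃ ψ ∈ closure φ, χ = .dia R ψ := by
  constructor
  · rintro ⟨h | ⟨R', ψ', hψ', h | h⟩, R, ψ, rfl⟩
    · exact ⟨R, ψ, mem_closure_of_dia h, rfl⟩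
    · exact ⟨R', ψ', hψ', h⟩
    · cases h
  · rintro ⟨R, ψ, hψ, rfl⟩
    exact ⟨Or.inr ⟨R, ψ, hψ, Or.inl rfl⟩, R, ψ, rfl⟩

theorem letters_subset_closure (φ : Formula P) : letters φ ⊆ closure φ := by
  rintro χ ⟨h, -⟩
  exact ⟨χ, h, Or.inl rfl⟩

theorem sigmaT_finite (φ : Formula P) : (sigmaT φ).Finite := by
  have hs : φ.subformulas.Finite := by
    induction φ with
    | letter a => exact Set.finite_singleton _
    | neg ψ ih => exact ih.insert _
    | or ψ χ ih₁ ih₂ => exact (ih₁.union ih₂).insert _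
    | dia R ψ ih => exact ih.insert _
  have hs' := hs.insert Formula.sim
  have hc : (closure φ).Finite := by
    refine (hs'.union (hs'.image Formula.compl)).subset ?_
    rintro ψ ⟨χ, hχ, rfl | rfl⟩
    · exact Or.inl hχ
    · exact Or.inr ⟨χ, hχ, rfl⟩
  have ht : (temporalRequests φ).Finite := by
    refine (((hc.image (Formula.dia .A)).union (hc.image (Formula.dia .B))).union
      (hc.image (Formula.dia .Bbar))).subset ?_
    intro χ hχ
    obtain ⟨R, ψ, hψ, rfl⟩ := mem_temporalRequests.1 hχ
    cases R
    · exact Or.inl (Or.inl ⟨ψ, hψ, rfl⟩)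
    · exact Or.inl (Or.inr ⟨ψ, hψ, rfl⟩)
    · exact Or.inr ⟨ψ, hψ, rfl⟩
  exact (hc.subset (letters_subset_closure φ)).union ht

/-! ### Success of a run as a condition on its labels -/

/-- Truth of a formula as far as a set of letters and requests decides it. -/
def LocalHolds (L : Set (Formula P)) : Formula P → Prop
  | .letter a => .letter a ∈ L
  | .neg ψ => ¬ LocalHolds L ψ
  | .or ψ χ => LocalHolds L ψ ∨ LocalHolds L χ
  | .dia R ψ => .dia R ψ ∈ L

/-- The labels `L x y` of the intervals `[x, y]`, `y < m`, describe a structure in which `∼` is an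
equivalence relation, `φ` holds at `[0, 0]`, and the requests are the true ones. -/
structure Coherent (φ : Formula P) (m : ℕ) (L : ℕ → ℕ → Set (Formula P)) : Prop where
  sim : ∃ r : Setoid ℕ, ∀ x y, x ≤ y → y < m → (Formula.sim ∈ L x y ↔ r x y)
  initial : LocalHolds (L 0 0) φ
  meets : ∀ x y, x ≤ y → y < m → ∀ ψ ∈ closure φ,
    (.dia .A ψ ∈ L x y ↔ ∃ z, y ≤ z ∧ z < m ∧ LocalHolds (L y z) ψ)
  begun : ∀ x y, x ≤ y → y < m → ∀ ψ ∈ closure φ,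
    (.dia .B ψ ∈ L x y ↔ ∃ z, x ≤ z ∧ z < y ∧ LocalHolds (L x z) ψ)
  begins : ∀ x y, x ≤ y → y < m → ∀ ψ ∈ closure φ,
    (.dia .Bbar ψ ∈ L x y ↔ ∃ z, y < z ∧ z < m ∧ LocalHolds (L x z) ψ)

/-- The structure over `Fin m` with the letters of the labels `L`. -/
def labelVal (m : ℕ) (L : ℕ → ℕ → Set (Formula P)) : NonemptyInterval (Fin m) → Set (Letter P) :=
  fun I => {a | Formula.letter a ∈ L I.fst.val I.snd.val}

theorem exists_nonemptyInterval_fin {m : ℕ} {Q : ℕ → ℕ → Prop} :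
    (∃ J : NonemptyInterval (Fin m), Q J.fst.val J.snd.val) ↔
      ∃ x y, x ≤ y ∧ y < m ∧ Q x y := by
  constructor
  · rintro ⟨J, h⟩
    exact ⟨_, _, J.fst_le_snd, J.snd.isLt, h⟩
  · rintro ⟨x, y, hxy, hy, h⟩
    exact ⟨⟨(⟨x, hxy.trans_lt hy⟩, ⟨y, hy⟩), hxy⟩, h⟩

/-- The modal step is left as the hypothesis `H` because it has two sources: the requests of a
successful run are true by definition, whereas for a coherent labelling this has to be derived. -/
theorem sat_iff_localHolds_of_dia {φ : Formula P} {m : ℕ} {L : ℕ → ℕ → Set (Formula P)}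
    (H : ∀ R, ∀ ψ ∈ closure φ,
      (∀ J, Sat (labelVal m L) ψ J ↔ LocalHolds (L J.fst.val J.snd.val) ψ) →
      ∀ I, Sat (labelVal m L) (.dia R ψ) I ↔ .dia R ψ ∈ L I.fst.val I.snd.val)
    {ψ : Formula P} (hψ : ψ ∈ closure φ) (I : NonemptyInterval (Fin m)) :
    Sat (labelVal m L) ψ I ↔ LocalHolds (L I.fst.val I.snd.val) ψ := by
  induction ψ generalizing I with
  | letter a => rfl
  | neg ψ ih => exact not_congr (ih (mem_closure_of_neg hψ) I)
  | or ψ χ ih₁ ih₂ =>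
    exact or_congr (ih₁ (mem_closure_of_or hψ).1 I) (ih₂ (mem_closure_of_or hψ).2 I)
  | dia R ψ ih =>
    exact H R ψ (mem_closure_of_dia hψ) (fun J => ih (mem_closure_of_dia hψ) J) I

theorem sat_dia_iff {m : ℕ} {L : ℕ → ℕ → Set (Formula P)} {ψ : Formula P}
    (h : ∀ J, Sat (labelVal m L) ψ J ↔ LocalHolds (L J.fst.val J.snd.val) ψ)
    (I : NonemptyInterval (Fin m)) :
    (Sat (labelVal m L) (.dia .A ψ) I ↔
      ∃ z, I.snd.val ≤ z ∧ z < m ∧ LocalHolds (L I.snd.val z) ψ) ∧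
    (Sat (labelVal m L) (.dia .B ψ) I ↔
      ∃ z, I.fst.val ≤ z ∧ z < I.snd.val ∧ LocalHolds (L I.fst.val z) ψ) ∧
    (Sat (labelVal m L) (.dia .Bbar ψ) I ↔
      ∃ z, I.snd.val < z ∧ z < m ∧ LocalHolds (L I.fst.val z) ψ) := by
  have hI : I.fst.val ≤ I.snd.val := I.fst_le_snd
  have hm : I.snd.val < m := I.snd.isLt
  simp only [Sat, h, Allen.Holds, Fin.ext_iff, Fin.lt_def]
  refine ⟨?_, ?_, ?_⟩
  · rw [exists_nonemptyInterval_fin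
      (Q := fun x y => I.snd.val = x ∧ LocalHolds (L x y) ψ)]
    constructor
    · rintro ⟨x, y, hxy, hy, rfl, h⟩
      exact ⟨y, hxy, hy, h⟩
    · rintro ⟨z, hz, hz', h⟩
      exact ⟨_, z, hz, hz', rfl, h⟩
  · rw [exists_nonemptyInterval_fin
      (Q := fun x y => (I.fst.val = x ∧ y < I.snd.val) ∧ LocalHolds (L x y) ψ)]
    constructor
    · rintro ⟨x, y, hxy, hy, ⟨rfl, hy'⟩, h⟩
      exact ⟨y, hxy, hy', h⟩
    · rintro ⟨z, hz, hz', h⟩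
      exact ⟨_, z, hz, hz'.trans hm, ⟨rfl, hz'⟩, h⟩
  · rw [exists_nonemptyInterval_fin
      (Q := fun x y => (I.fst.val = x ∧ I.snd.val < y) ∧ LocalHolds (L x y) ψ)]
    constructor
    · rintro ⟨x, y, hxy, hy, ⟨rfl, hy'⟩, h⟩
      exact ⟨y, hy', hy, h⟩
    · rintro ⟨z, hz, hz', h⟩
      exact ⟨_, z, hI.trans hz.le, hz', ⟨rfl, hz⟩, h⟩

/-- The conditions on the structure induced by a successful run, in terms of its labels. -/
def LabelsSuccessful (φ : Formula P) (m : ℕ) (L : ℕ → ℕ → Set (Formula P)) : Prop :=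
  SimIsEquivalence (labelVal m L) ∧
    (∀ I : NonemptyInterval (Fin m), I.fst.val = 0 → I.snd.val = 0 → Sat (labelVal m L) φ I) ∧
    ∀ I : NonemptyInterval (Fin m), ∀ ψ ∈ temporalRequests φ,
      Sat (labelVal m L) ψ I ↔ ψ ∈ L I.fst.val I.snd.val

theorem LabelsSuccessful.sat_iff {φ : Formula P} {m : ℕ} {L : ℕ → ℕ → Set (Formula P)}
    (h : LabelsSuccessful φ m L) {ψ : Formula P} (hψ : ψ ∈ closure φ)
    (I : NonemptyInterval (Fin m)) :
    Sat (labelVal m L) ψ I ↔ LocalHolds (L I.fst.val I.snd.val) ψ :=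
  sat_iff_localHolds_of_dia
    (fun R ψ hψ _ I => h.2.2 I _ (mem_temporalRequests.2 ⟨R, ψ, hψ, rfl⟩)) hψ I

theorem labelsSuccessful_iff_coherent {φ : Formula P} {m : ℕ} (hm : 0 < m)
    {L : ℕ → ℕ → Set (Formula P)} : LabelsSuccessful φ m L ↔ Coherent φ m L := by
  constructor
  · intro h
    have hsat := fun ψ hψ => h.sat_iff (ψ := ψ) hψ
    have req : ∀ R, ∀ ψ ∈ closure φ, ∀ I : NonemptyInterval (Fin m),
        Formula.dia R ψ ∈ L I.fst.val I.snd.val ↔ Sat (labelVal m L) (.dia R ψ) I :=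
      fun R ψ hψ I => (h.2.2 I _ (mem_temporalRequests.2 ⟨R, ψ, hψ, rfl⟩)).symm
    refine ⟨?_, ?_, ?_, ?_, ?_⟩
    · obtain ⟨r, hr⟩ := h.1
      -- Points from `m` on are sent to the arbitrary point `0`; coherence never inspects them.
      refine ⟨r.comap (fun x => if hx : x < m then ⟨x, hx⟩ else ⟨0, hm⟩), ?_⟩
      intro x y hxy hy
      have hx := hxy.trans_lt hy
      have := hr ⟨(⟨x, hx⟩, ⟨y, hy⟩), hxy⟩
      simpa [Setoid.comap_rel, hx, hy, labelVal, Formula.sim] using this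
    · exact (hsat φ (self_mem_closure φ) ⟨(⟨0, hm⟩, ⟨0, hm⟩), le_rfl⟩).1 (h.2.1 _ rfl rfl)
    · intro x y hxy hy ψ hψ
      exact (req .A ψ hψ ⟨(⟨x, hxy.trans_lt hy⟩, ⟨y, hy⟩), hxy⟩).trans
        (sat_dia_iff (hsat ψ hψ) _).1
    · intro x y hxy hy ψ hψ
      exact (req .B ψ hψ ⟨(⟨x, hxy.trans_lt hy⟩, ⟨y, hy⟩), hxy⟩).trans
        (sat_dia_iff (hsat ψ hψ) _).2.1
    · intro x y hxy hy ψ hψ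
      exact (req .Bbar ψ hψ ⟨(⟨x, hxy.trans_lt hy⟩, ⟨y, hy⟩), hxy⟩).trans
        (sat_dia_iff (hsat ψ hψ) _).2.2
  · intro h
    have key : ∀ R, ∀ ψ ∈ closure φ,
        (∀ J, Sat (labelVal m L) ψ J ↔ LocalHolds (L J.fst.val J.snd.val) ψ) →
        ∀ I, Sat (labelVal m L) (.dia R ψ) I ↔ .dia R ψ ∈ L I.fst.val I.snd.val := by
      intro R ψ hψ hJ I
      have := sat_dia_iff hJ I
      cases R
      · exact this.1.trans (h.meets _ _ I.fst_le_snd I.snd.isLt ψ hψ).symm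
      · exact this.2.1.trans (h.begun _ _ I.fst_le_snd I.snd.isLt ψ hψ).symm
      · exact this.2.2.trans (h.begins _ _ I.fst_le_snd I.snd.isLt ψ hψ).symm
    have hsat := fun ψ hψ => sat_iff_localHolds_of_dia key (ψ := ψ) hψ
    refine ⟨?_, ?_, ?_⟩
    · obtain ⟨r, hr⟩ := h.sim
      exact ⟨r.comap Fin.val, fun I => hr _ _ I.fst_le_snd I.snd.isLt⟩
    · intro I h0 h1
      rw [hsat φ (self_mem_closure φ), h0, h1]
      exact h.initial
    · intro I ψ hψ
      obtain ⟨R, χ, hχ, rfl⟩ := mem_temporalRequests.1 hψ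
      exact key R χ hχ (hsat χ hχ) I

/-! ### Contraction of a coherent structure -/

/-- The map from the points of a contracted structure to the points of the original one. -/
def embed (f : ℕ → ℕ) (y d x : ℕ) : ℕ := if x ≤ y then f x else x + d

/-- Removing the rows `y + 1, …, y + d` from a coherent structure, where `f` sends the points up to
`y` to points up to `y + d` so that the labels of row `y` recur in row `y + d`. -/
theorem Coherent.contract {φ : Formula P} {m y d : ℕ} {L L' : ℕ → ℕ → Set (Formula P)}
    {f : ℕ → ℕ} (h : Coherent φ (m + d) L) (hy : y < m) (hf : ∀ x ≤ y, f x ≤ y + d)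
    (hlab : ∀ x ≤ y, L x y = L (f x) (y + d))
    (hsim : ∀ x x', x ≤ x' → x' ≤ y →
      (Formula.sim ∈ L x x' ↔ Formula.sim ∈ L (min (f x) (f x')) (max (f x) (f x'))))
    (hlow : ∀ x j, x ≤ j → j ≤ y → L' x j = L x j)
    (hhigh : ∀ x j, x ≤ j → y < j → j < m → L' x j = L (embed f y d x) (j + d)) :
    Coherent φ m L' := by
  have hlow' : ∀ x j, x ≤ y → y < j → j < m → L' x j = L (f x) (j + d) := by
    intro x j hx hj hm
    rw [hhigh x j (by omega) hj hm, embed, if_pos hx]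
  have hnew : ∀ x j, y < x → x ≤ j → j < m → L' x j = L (x + d) (j + d) := by
    intro x j hx hj hm
    rw [hhigh x j (by omega) (by omega) hm, embed, if_neg (by omega)]
  -- The `⟨B̄⟩`-requests in the common label of `(x, y)` and `(f x, y + d)` decide what occurs above
  -- in either column, so the part above row `y` can be exchanged for the part above row `y + d`.
  have above : ∀ ψ ∈ closure φ, ∀ x ≤ y, (∃ z, y < z ∧ z < m + d ∧ LocalHolds (L x z) ψ) ↔
      ∃ z, y < z ∧ z < m ∧ LocalHolds (L' x z) ψ := by
    intro ψ hψ x hx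
    rw [← h.begins x y hx (by omega) ψ hψ, hlab x hx,
      h.begins (f x) (y + d) (hf x hx) (by omega) ψ hψ]
    constructor
    · rintro ⟨z, hz, hz', hL⟩
      obtain ⟨k, rfl⟩ : ∃ k, z = k + d := ⟨z - d, by omega⟩
      exact ⟨k, by omega, by omega, by rwa [hlow' x k hx (by omega) (by omega)]⟩
    · rintro ⟨z, hz, hz', hL⟩
      exact ⟨z + d, by omega, by omega, by rwa [hlow' x z hx hz hz'] at hL⟩
  -- Dually with `⟨B⟩`-requests. These look strictly below, and the endpoints `y` and `y + d`
  -- themselves are matched by the equality of the two labels.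
  have below : ∀ ψ ∈ closure φ, ∀ x ≤ y,
      (∃ z, f x ≤ z ∧ z ≤ y + d ∧ LocalHolds (L (f x) z) ψ) ↔
        ∃ z, x ≤ z ∧ z ≤ y ∧ LocalHolds (L' x z) ψ := by
    intro ψ hψ x hx
    have h₁ := h.begun x y hx (by omega) ψ hψ
    have h₂ := h.begun (f x) (y + d) (hf x hx) (by omega) ψ hψ
    rw [← hlab x hx] at h₂
    constructor
    · rintro ⟨z, hz, hz', hL⟩
      rcases hz'.eq_or_lt with rfl | hz'
      · exact ⟨y, hx, le_rfl, by rwa [hlow x y hx le_rfl, hlab x hx]⟩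
      · obtain ⟨k, hk, hk', hL'⟩ := h₁.1 (h₂.2 ⟨z, hz, hz', hL⟩)
        exact ⟨k, hk, hk'.le, by rwa [hlow x k hk hk'.le]⟩
    · rintro ⟨z, hz, hz', hL⟩
      rw [hlow x z hz hz'] at hL
      rcases hz'.eq_or_lt with rfl | hz'
      · exact ⟨z + d, hf x hx, le_rfl, by rwa [← hlab x hx]⟩
      · obtain ⟨k, hk, hk', hL'⟩ := h₂.1 (h₁.2 ⟨z, hz, hz', hL⟩)
        exact ⟨k, hk, hk'.le, hL'⟩
  refine ⟨?_, ?_, ?_, ?_, ?_⟩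
  · obtain ⟨r, hr⟩ := h.sim
    refine ⟨r.comap (embed f y d), ?_⟩
    intro x j hxj hj
    rw [Setoid.comap_rel]
    by_cases hjy : j ≤ y
    · rw [hlow x j hxj hjy, hsim x j hxj hjy, embed, embed, if_pos hjy, if_pos (hxj.trans hjy)]
      have h₁ := hf x (hxj.trans hjy)
      have h₂ := hf j hjy
      rw [hr _ _ min_le_max (by omega)]
      -- `f` need not be monotone; symmetry of `∼` makes up for it.
      rcases le_total (f x) (f j) with hle | hle
      · rw [min_eq_left hle, max_eq_right hle]
      · rw [min_eq_right hle, max_eq_left hle]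
        exact ⟨r.symm, r.symm⟩
    · rw [hhigh x j hxj (by omega) hj]
      have : embed f y d j = j + d := if_neg hjy
      rw [this]
      refine hr _ _ ?_ (by omega)
      unfold embed
      split_ifs with hx
      · have := hf x hx
        omega
      · omega
  · rw [hlow 0 0 le_rfl (Nat.zero_le _)]
    exact h.initial
  · intro x j hxj hj ψ hψ
    by_cases hjy : j ≤ y
    · rw [hlow x j hxj hjy, h.meets x j hxj (by omega) ψ hψ]
      constructor
      · rintro ⟨z, hz, hz', hL⟩
        by_cases hzy : z ≤ y
        · exact ⟨z, hz, by omega, by rwa [hlow j z hz hzy]⟩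
        · obtain ⟨k, hk, hk', hL'⟩ := (above ψ hψ j hjy).1 ⟨z, by omega, hz', hL⟩
          exact ⟨k, by omega, hk', hL'⟩
      · rintro ⟨z, hz, hz', hL⟩
        by_cases hzy : z ≤ y
        · exact ⟨z, hz, by omega, by rwa [hlow j z hz hzy] at hL⟩
        · obtain ⟨k, hk, hk', hL'⟩ := (above ψ hψ j hjy).2 ⟨z, by omega, hz', hL⟩
          exact ⟨k, by omega, hk', hL'⟩
    · have hx : embed f y d x ≤ j + d := by
        unfold embed
        split_ifs with hx
        · have := hf x hx
          omega
        · omega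
      rw [hhigh x j hxj (by omega) hj, h.meets _ (j + d) hx (by omega) ψ hψ]
      constructor
      · rintro ⟨z, hz, hz', hL⟩
        obtain ⟨k, rfl⟩ : ∃ k, z = k + d := ⟨z - d, by omega⟩
        exact ⟨k, by omega, by omega, by rwa [hnew j k (by omega) (by omega) (by omega)]⟩
      · rintro ⟨z, hz, hz', hL⟩
        exact ⟨z + d, by omega, by omega, by rwa [hnew j z (by omega) hz hz'] at hL⟩
  · intro x j hxj hj ψ hψ
    by_cases hjy : j ≤ y
    · rw [hlow x j hxj hjy, h.begun x j hxj (by omega) ψ hψ]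
      refine exists_congr fun z => and_congr_right fun hz => and_congr_right fun hz' => ?_
      rw [hlow x z hz (by omega)]
    · by_cases hx : x ≤ y
      · have hfx := hf x hx
        rw [hlow' x j hx (by omega) hj, h.begun _ (j + d) (by omega) (by omega) ψ hψ]
        constructor
        · rintro ⟨z, hz, hz', hL⟩
          by_cases hzy : z ≤ y + d
          · obtain ⟨k, hk, hk', hL'⟩ := (below ψ hψ x hx).1 ⟨z, hz, hzy, hL⟩
            exact ⟨k, hk, by omega, hL'⟩
          · obtain ⟨k, rfl⟩ : ∃ k, z = k + d := ⟨z - d, by omega⟩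
            exact ⟨k, by omega, by omega, by rwa [hlow' x k hx (by omega) (by omega)]⟩
        · rintro ⟨z, hz, hz', hL⟩
          by_cases hzy : z ≤ y
          · obtain ⟨k, hk, hk', hL'⟩ := (below ψ hψ x hx).2 ⟨z, hz, hzy, hL⟩
            exact ⟨k, hk, by omega, hL'⟩
          · exact ⟨z + d, by omega, by omega,
              by rwa [hlow' x z hx (by omega) (by omega)] at hL⟩
      · rw [hnew x j (by omega) hxj hj, h.begun _ (j + d) (by omega) (by omega) ψ hψ]
        constructor
        · rintro ⟨z, hz, hz', hL⟩
          obtain ⟨k, rfl⟩ : ∃ k, z = k + d := ⟨z - d, by omega⟩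
          exact ⟨k, by omega, by omega, by rwa [hnew x k (by omega) (by omega) (by omega)]⟩
        · rintro ⟨z, hz, hz', hL⟩
          exact ⟨z + d, by omega, by omega,
            by rwa [hnew x z (by omega) hz (by omega)] at hL⟩
  · intro x j hxj hj ψ hψ
    by_cases hjy : j ≤ y
    · rw [hlow x j hxj hjy, h.begins x j hxj (by omega) ψ hψ]
      constructor
      · rintro ⟨z, hz, hz', hL⟩
        by_cases hzy : z ≤ y
        · exact ⟨z, hz, by omega, by rwa [hlow x z (by omega) hzy]⟩
        · obtain ⟨k, hk, hk', hL'⟩ := (above ψ hψ x (by omega)).1 ⟨z, by omega, hz', hL⟩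
          exact ⟨k, by omega, hk', hL'⟩
      · rintro ⟨z, hz, hz', hL⟩
        by_cases hzy : z ≤ y
        · exact ⟨z, hz, by omega, by rwa [hlow x z (by omega) hzy] at hL⟩
        · obtain ⟨k, hk, hk', hL'⟩ := (above ψ hψ x (by omega)).2 ⟨z, by omega, hz', hL⟩
          exact ⟨k, by omega, hk', hL'⟩
    · have hx : embed f y d x ≤ j + d := by
        unfold embed
        split_ifs with hx
        · have := hf x hx
          omega
        · omega
      rw [hhigh x j hxj (by omega) hj, h.begins _ (j + d) hx (by omega) ψ hψ]
      constructor
      · rintro ⟨z, hz, hz', hL⟩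
        obtain ⟨k, rfl⟩ : ∃ k, z = k + d := ⟨z - d, by omega⟩
        exact ⟨k, by omega, by omega, by rwa [hhigh x k (by omega) (by omega) (by omega)]⟩
      · rintro ⟨z, hz, hz', hL⟩
        exact ⟨z + d, by omega, by omega,
          by rwa [hhigh x z (by omega) (by omega) hz'] at hL⟩

/-! ### Rounds, plays and their labels -/

/-- A move of Spoiler together with Duplicator's answer. -/
structure Round (P : Type*) where
  interval : NonemptyInterval ℕ
  spoiler : Set (Formula P)
  duplicator : Set (Formula P)

instance : Inhabited (Round P) := ⟨⟨NonemptyInterval.pure 0, ∅, ∅⟩⟩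

/-- Spoiler's move in a round. -/
def Round.move (r : Round P) : Move P := (r.interval, r.spoiler)

/-- The run that consists of the given rounds. -/
def unroll (p : List (Round P)) : List (Move P) :=
  p.flatMap fun r => [(r.interval, r.spoiler), (r.interval, r.duplicator)]

theorem length_unroll (p : List (Round P)) : (unroll p).length = 2 * p.length := by
  induction p with
  | nil => rfl
  | cons r p ih =>
    change (unroll p).length + 1 + 1 = 2 * (p.length + 1)
    omega

/-- The sequence of moves of a finite or infinite sequence of rounds. -/
noncomputable def interleave (q : ℕ → Option (Round P)) (i : ℕ) : Option (Move P) :=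
  (q (i / 2)).map fun r => (r.interval, if i % 2 = 0 then r.spoiler else r.duplicator)

theorem getElem?_unroll (p : List (Round P)) (i : ℕ) :
    (unroll p)[i]? = interleave (fun k => p[k]?) i := by
  induction p generalizing i with
  | nil => simp [unroll, interleave]
  | cons r p ih =>
    match i with
    | 0 => rfl
    | 1 => rfl
    | i + 2 =>
      change (unroll p)[i]? = _
      rw [ih, interleave, interleave, Nat.add_mod_right, Nat.add_div_right _ two_pos]
      rfl

/-- The interval `[x, j]` occurs in one of the rounds. -/
def Visited (p : List (Round P)) (x j : ℕ) : Prop :=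
  ∃ r ∈ p, r.interval.fst = x ∧ r.interval.snd = j

/-- Spoiler may choose the interval `[x, j]` after the given rounds. -/
def Legal (p : List (Round P)) (x j : ℕ) : Prop :=
  ¬ Visited p x j ∧ ∀ x' j', x' ≤ j' → j' < j → Visited p x' j'

/-- All rounds obey the rules of the game. -/
def IsPlay (φ : Formula P) (S : Set (Formula P)) (p : List (Round P)) : Prop :=
  ∀ q r, q ++ [r] <+: p →
    Legal q r.interval.fst r.interval.snd ∧ r.spoiler ⊆ S ∧ r.duplicator ⊆ sigmaT φ \ S

/-- The letters and requests that the rounds put on `[x, j]`. -/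
def label (p : List (Round P)) (x j : ℕ) : Set (Formula P) :=
  {ψ | ∃ r ∈ p, (r.interval.fst = x ∧ r.interval.snd = j) ∧ (ψ ∈ r.spoiler ∨ ψ ∈ r.duplicator)}

theorem visited_iff_mem {p : List (Round P)} {I : NonemptyInterval ℕ} :
    Visited p I.fst I.snd ↔ ∃ r ∈ p, r.interval = I :=
  exists_congr fun _ => and_congr_right fun _ =>
    ⟨fun h => NonemptyInterval.ext (Prod.ext h.1 h.2), fun h => by simp [h]⟩

theorem Visited.le {p : List (Round P)} {x j : ℕ} (h : Visited p x j) : x ≤ j := by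
  obtain ⟨r, -, rfl, rfl⟩ := h
  exact r.interval.fst_le_snd

theorem Visited.mono {p q : List (Round P)} {x j : ℕ} (h : Visited p x j) (hpq : p <+: q) :
    Visited q x j :=
  h.imp fun _ hr => ⟨hpq.subset hr.1, hr.2⟩

theorem visited_concat {p : List (Round P)} {r : Round P} {x j : ℕ} :
    Visited (p ++ [r]) x j ↔ Visited p x j ∨ (r.interval.fst = x ∧ r.interval.snd = j) := by
  simp [Visited, or_and_right, exists_or]

theorem not_visited_nil {x j : ℕ} : ¬ Visited ([] : List (Round P)) x j := by
  simp [Visited]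

theorem label_concat {p : List (Round P)} {r : Round P} {x j : ℕ}
    (h : ¬ (r.interval.fst = x ∧ r.interval.snd = j)) : label (p ++ [r]) x j = label p x j := by
  ext ψ
  simp only [label, List.mem_append, List.mem_singleton, Set.mem_ofPred_eq]
  constructor
  · rintro ⟨t, ht | rfl, h', hψ⟩
    · exact ⟨t, ht, h', hψ⟩
    · exact absurd h' h
  · rintro ⟨t, ht, h', hψ⟩
    exact ⟨t, Or.inl ht, h', hψ⟩

theorem label_concat_self {p : List (Round P)} {r : Round P}
    (h : ¬ Visited p r.interval.fst r.interval.snd) :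
    label (p ++ [r]) r.interval.fst r.interval.snd = r.spoiler ∪ r.duplicator := by
  ext ψ
  simp only [label, List.mem_append, List.mem_singleton, Set.mem_ofPred_eq]
  constructor
  · rintro ⟨t, ht | rfl, h', hψ⟩
    · exact absurd ⟨t, ht, h'⟩ h
    · exact hψ
  · intro hψ
    exact ⟨r, Or.inr rfl, ⟨rfl, rfl⟩, hψ⟩

theorem runLabel_unroll (p : List (Round P)) (I : NonemptyInterval ℕ) :
    runLabel (unroll p) I = label p I.fst I.snd := by
  ext ψ
  simp only [runLabel, unroll, List.mem_flatMap, label, Set.mem_ofPred_eq]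
  constructor
  · rintro ⟨s, ⟨r, hr, hs⟩, rfl, hψ⟩
    rcases List.mem_pair.1 hs with rfl | rfl
    · exact ⟨r, hr, ⟨rfl, rfl⟩, Or.inl hψ⟩
    · exact ⟨r, hr, ⟨rfl, rfl⟩, Or.inr hψ⟩
  · rintro ⟨r, hr, h, hψ | hψ⟩
    · exact ⟨_, ⟨r, hr, List.mem_pair.2 (Or.inl rfl)⟩,
        NonemptyInterval.ext (Prod.ext h.1 h.2), hψ⟩
    · exact ⟨_, ⟨r, hr, List.mem_pair.2 (Or.inr rfl)⟩,
        NonemptyInterval.ext (Prod.ext h.1 h.2), hψ⟩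

theorem inducedVal_unroll (p : List (Round P)) (m : ℕ) :
    inducedVal (unroll p) m = labelVal m (label p) := by
  funext I
  simp only [inducedVal, labelVal, runLabel_unroll]
  rfl

section Plays

variable {φ : Formula P} {S : Set (Formula P)} {p q : List (Round P)} {r : Round P}

theorem isPlay_nil : IsPlay φ S ([] : List (Round P)) := by
  intro q r h
  simp at h

theorem IsPlay.of_prefix (h : IsPlay φ S p) (hq : q <+: p) : IsPlay φ S q :=
  fun _ _ h' => h _ _ (h'.trans hq)

theorem isPlay_concat : IsPlay φ S (p ++ [r]) ↔ IsPlay φ S p ∧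
    Legal p r.interval.fst r.interval.snd ∧ r.spoiler ⊆ S ∧ r.duplicator ⊆ sigmaT φ \ S := by
  constructor
  · exact fun h => ⟨h.of_prefix (List.prefix_append _ _), h _ _ (List.prefix_refl _)⟩
  · rintro ⟨h, h'⟩ q t hq
    rcases List.prefix_concat_iff.1 hq with hq | hq
    · obtain ⟨rfl, ht⟩ := List.append_inj' hq rfl
      cases ht
      exact h'
    · exact h _ _ hq

theorem IsPlay.nodup (h : IsPlay φ S p) : (p.map Round.interval).Nodup := by
  induction p using List.reverseRecOn with
  | nil => simp
  | append_singleton p r ih =>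
    obtain ⟨hp, hl, -⟩ := isPlay_concat.1 h
    rw [List.map_append, List.nodup_append]
    refine ⟨ih hp, by simp, ?_⟩
    simp only [List.mem_map, List.map_cons, List.map_nil, List.mem_singleton]
    rintro _ ⟨t, ht, rfl⟩ _ rfl heq
    exact hl.1 (visited_iff_mem.2 ⟨t, ht, heq⟩)

theorem IsPlay.label_subset (h : IsPlay φ S p) (hS : S ⊆ sigmaT φ) (x j : ℕ) :
    label p x j ⊆ sigmaT φ := by
  rintro ψ ⟨r, hr, -, hψ⟩
  obtain ⟨q, t, rfl⟩ := List.append_of_mem hr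
  have := h q r ⟨t, by simp⟩
  exact hψ.elim (fun h => hS (this.2.1 h)) (fun h => (this.2.2 h).1)

/-- No interval is chosen twice, so later rounds cannot alter the label of a visited one. -/
theorem IsPlay.label_eq (h : IsPlay φ S p) (hq : q <+: p) {x j : ℕ} (hv : Visited q x j) :
    label p x j = label q x j := by
  induction p using List.reverseRecOn with
  | nil => rw [List.prefix_nil.1 hq]
  | append_singleton p r ih =>
    obtain ⟨hp, hl, -⟩ := isPlay_concat.1 h
    rcases List.prefix_concat_iff.1 hq with rfl | hq
    · rfl
    · rw [label_concat, ih hp hq]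
      rintro ⟨rfl, rfl⟩
      exact hl.1 (hv.mono hq)

/-! ### Plays as admissible runs -/

/-- The rules of the game for finite or infinite sequences of rounds. -/
theorem RunRules.of_legal {q : ℕ → Option (Round P)}
    (h : ∀ k r, q k = some r → r.spoiler ⊆ S ∧ r.duplicator ⊆ sigmaT φ \ S ∧
      (∀ l < k, ∀ t, q l = some t → t.interval ≠ r.interval) ∧
      ∀ I : NonemptyInterval ℕ, I.snd < r.interval.snd →
        ∃ l < k, ∃ t, q l = some t ∧ t.interval = I) :
    RunRules φ S (interleave q) := by
  have inv : ∀ {i s}, interleave q i = some s → ∃ r, q (i / 2) = some r ∧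
      (r.interval, if i % 2 = 0 then r.spoiler else r.duplicator) = s := by
    intro i s hs
    exact Option.map_eq_some_iff.1 hs
  refine ⟨?_, ?_, ?_, ?_⟩
  · intro s hs
    obtain ⟨r, hr, rfl⟩ := inv hs
    have hr' : r.interval.snd = 0 := by
      by_contra hne
      obtain ⟨l, hl, -⟩ := (h _ r hr).2.2.2 (NonemptyInterval.pure 0) (Nat.pos_of_ne_zero hne)
      omega
    exact ⟨Nat.le_zero.1 (hr' ▸ r.interval.fst_le_snd), hr'⟩
  · intro i s t hi hs ht
    obtain ⟨r, hr, rfl⟩ := inv hs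
    obtain ⟨r', hr', rfl⟩ := inv ht
    have hi' := Nat.even_iff.1 hi
    rw [show (i + 1) / 2 = i / 2 by omega, hr, Option.some.injEq] at hr'
    subst hr'
    rw [if_pos hi', if_neg (by omega)]
    exact ⟨rfl, (h _ _ hr).1, (h _ _ hr).2.1⟩
  · intro i j s t hi h₁ h₂ hs ht
    obtain ⟨r, hr, rfl⟩ := inv hs
    obtain ⟨r', hr', rfl⟩ := inv ht
    have hi' := Nat.even_iff.1 hi
    rcases lt_trichotomy (i / 2) (j / 2) with hlt | heq | hlt
    · exact (h _ _ hr').2.2.1 _ hlt _ hr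
    · omega
    · exact ((h _ _ hr).2.2.1 _ hlt _ hr').symm
  · intro i s t hs ht hne
    obtain ⟨r, hr, rfl⟩ := inv hs
    obtain ⟨r', hr', rfl⟩ := inv ht
    have hk : (i + 1) / 2 = i / 2 + 1 := by
      by_contra hk
      rw [show (i + 1) / 2 = i / 2 by omega, hr, Option.some.injEq] at hr'
      subst hr'
      exact hne rfl
    rw [hk] at hr'
    dsimp only at hne ⊢
    have h₁ := h _ _ hr
    have h₂ := h _ _ hr'
    refine ⟨?_, ?_⟩
    · rcases lt_or_gt_of_ne hne with hlt | hgt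
      -- A step down would go to an interval that had to be visited before the current one.
      · obtain ⟨l, hl, t, ht, heq⟩ := h₁.2.2.2 _ hlt
        exact absurd heq (h₂.2.2.1 l (by omega) t ht)
      -- After a jump by two or more, the point interval in the skipped row must have been visited
      -- earlier. Legality at that earlier time would require the current interval to have been
      -- visited even before.
      · by_contra hne'
        obtain ⟨l, hl, t, ht, heq⟩ :=
          h₂.2.2.2 (NonemptyInterval.pure (r.interval.snd + 1)) (by simp; omega)
        have hts : t.interval.snd = r.interval.snd + 1 := by rw [heq]; rfl
        have hl' : l ≠ i / 2 := by
          rintro rfl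
          rw [hr, Option.some.injEq] at ht
          subst ht
          omega
        obtain ⟨l', hl'', t', ht', heq'⟩ := (h _ _ ht).2.2.2 r.interval (by omega)
        exact h₁.2.2.1 l' (by omega) t' ht' heq'
    · intro I hI
      obtain ⟨l, hl, t, ht, heq⟩ := h₂.2.2.2 I hI
      exact ⟨2 * l, by omega, (t.interval, t.spoiler), by simp [interleave, ht], heq⟩

theorem IsPlay.legal_take (h : IsPlay φ S p) {k : ℕ} (hk : p[k]? = some r) :
    Legal (p.take k) r.interval.fst r.interval.snd ∧ r.spoiler ⊆ S ∧
      r.duplicator ⊆ sigmaT φ \ S := by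
  refine h _ _ ?_
  have : p.take k ++ [r] = p.take (k + 1) := by simp [List.take_add_one, hk]
  rw [this]
  exact List.take_prefix _ _

theorem mem_take_iff {k : ℕ} : r ∈ p.take k ↔ ∃ l < k, p[l]? = some r := by
  rw [List.mem_iff_getElem?]
  simp only [List.getElem?_take]
  refine exists_congr fun l => ?_
  split_ifs with h <;> simp [h]

theorem IsPlay.runRules (h : IsPlay φ S p) : RunRules φ S (fun i => (unroll p)[i]?) := by
  simp only [getElem?_unroll]
  refine RunRules.of_legal fun k r hk => ?_
  obtain ⟨hl, h₁, h₂⟩ := h.legal_take hk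
  refine ⟨h₁, h₂, ?_, ?_⟩
  · intro l hlk t ht heq
    exact hl.1 (visited_iff_mem.2 ⟨t, mem_take_iff.2 ⟨l, hlk, ht⟩, heq⟩)
  · intro I hI
    obtain ⟨t, ht, heq⟩ := visited_iff_mem.1 (hl.2 _ _ I.fst_le_snd hI)
    obtain ⟨l, hlk, hl'⟩ := mem_take_iff.1 ht
    exact ⟨l, hlk, t, hl', heq⟩

/-- The intervals with right endpoint less than `m`. -/
def rows : ℕ → Finset (NonemptyInterval ℕ)
  | 0 => ∅
  | m + 1 => rows m ∪ (Finset.range (m + 1)).image fun x => ⟨(min x m, m), min_le_right x m⟩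

theorem mem_rows {m : ℕ} {I : NonemptyInterval ℕ} : I ∈ rows m ↔ I.snd < m := by
  induction m with
  | zero => simp [rows]
  | succ m ih =>
    rw [rows, Finset.mem_union, ih, Finset.mem_image]
    constructor
    · rintro (h | ⟨x, -, rfl⟩)
      · omega
      · exact Nat.lt_succ_self m
    · intro h
      rcases Nat.lt_succ_iff_lt_or_eq.1 h with h | h
      · exact Or.inl h
      · have hle := I.fst_le_snd
        refine Or.inr ⟨I.fst, Finset.mem_range.2 (by omega), ?_⟩
        refine NonemptyInterval.ext (Prod.ext ?_ h.symm)
        exact min_eq_left (by omega)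

theorem two_mul_card_rows (m : ℕ) : 2 * (rows m).card = m * (m + 1) := by
  induction m with
  | zero => simp [rows]
  | succ m ih =>
    rw [rows, Finset.card_union_of_disjoint, Finset.card_image_of_injOn, Finset.card_range]
    · linarith
    · intro x hx x' hx' h
      have hx := Finset.mem_range.1 hx
      have hx' := Finset.mem_range.1 hx'
      have h' : min x m = min x' m := congrArg (fun I : NonemptyInterval ℕ => I.fst) h
      omega
    · rw [Finset.disjoint_left]
      intro I hI hI'
      obtain ⟨x, -, rfl⟩ := Finset.mem_image.1 hI'
      exact lt_irrefl _ (mem_rows.1 hI)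

/-- The rounds visit exactly the intervals with right endpoint less than `m`. -/
def VisitsRows (p : List (Round P)) (m : ℕ) : Prop :=
  ∀ x j, x ≤ j → (Visited p x j ↔ j < m)

theorem VisitsRows.mem_iff {m : ℕ} (h : VisitsRows p m) (I : NonemptyInterval ℕ) :
    I ∈ (p.map Round.interval) ↔ I ∈ rows m := by
  rw [mem_rows, ← h _ _ I.fst_le_snd, visited_iff_mem, List.mem_map]

-- A counting argument: the prescribed length is twice the number of intervals in the rows below
-- `m`, and the rounds of a play use distinct intervals, so covering these rows leaves no room for
-- any other interval.
open Classical in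
theorem IsPlay.isFiniteRun_iff (h : IsPlay φ S p) {m : ℕ} :
    IsFiniteRun φ S m (unroll p) ↔ 0 < m ∧ VisitsRows p m := by
  have hcard : (p.map Round.interval).toFinset.card = p.length := by
    rw [List.toFinset_card_of_nodup h.nodup, List.length_map]
  have hmem : ∀ I, (∃ s ∈ unroll p, s.1 = I) ↔ I ∈ p.map Round.interval := by
    intro I
    simp only [unroll, List.mem_flatMap, List.mem_map]
    constructor
    · rintro ⟨s, ⟨r, hr, hs⟩, rfl⟩
      rcases List.mem_pair.1 hs with rfl | rfl <;> exact ⟨r, hr, rfl⟩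
    · rintro ⟨r, hr, rfl⟩
      exact ⟨_, ⟨r, hr, List.mem_pair.2 (Or.inl rfl)⟩, rfl⟩
  constructor
  · intro hrun
    refine ⟨hrun.pos, ?_⟩
    have hsub : rows m ⊆ (p.map Round.interval).toFinset := by
      intro I hI
      rw [List.mem_toFinset, ← hmem]
      exact hrun.covers I (mem_rows.1 hI)
    have heq := Finset.eq_of_subset_of_card_le hsub (by
      have h₁ := hrun.length_eq
      have h₂ := two_mul_card_rows m
      rw [length_unroll] at h₁
      omega)
    intro x j hxj
    have h₁ := mem_rows (m := m) (I := ⟨(x, j), hxj⟩)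
    rw [heq, List.mem_toFinset, List.mem_map, ← visited_iff_mem] at h₁
    exact h₁
  · rintro ⟨hm, hv⟩
    have heq : (p.map Round.interval).toFinset = rows m := by
      ext I
      rw [List.mem_toFinset, hv.mem_iff]
    refine ⟨hm, ?_, ?_, h.runRules⟩
    · rw [length_unroll, ← hcard, heq, two_mul_card_rows]
    · intro I hI
      rw [hmem, hv.mem_iff, mem_rows]
      exact hI

theorem IsPlay.isSuccessful_iff (h : IsPlay φ S p) :
    IsSuccessful φ S (unroll p) ↔ ∃ m, 0 < m ∧ VisitsRows p m ∧ Coherent φ m (label p) := by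
  refine exists_congr fun m => ?_
  rw [h.isFiniteRun_iff, and_assoc]
  refine and_congr_right fun hm => and_congr_right fun _ => ?_
  rw [← labelsSuccessful_iff_coherent hm, LabelsSuccessful, inducedVal_unroll]
  simp only [runLabel_unroll]
  rfl

/-! ### Continuing plays, and Spoiler sequences -/

theorem exists_not_visited (p : List (Round P)) : ∃ x, ¬ Visited p x x := by
  classical
  obtain ⟨x, hx⟩ := Infinite.exists_notMem_finset
    (p.map fun r => r.interval.snd).toFinset
  refine ⟨x, ?_⟩
  rintro ⟨r, hr, -, rfl⟩
  exact hx (List.mem_toFinset.2 (List.mem_map.2 ⟨r, hr, rfl⟩))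

/-- An unvisited interval fails to be legal only because of an unvisited one in a lower row, and
this descent stops. -/
theorem exists_legal_le {p : List (Round P)} {x j : ℕ} (hxj : x ≤ j) (h : ¬ Visited p x j) :
    ∃ x' j', x' ≤ j' ∧ j' ≤ j ∧ Legal p x' j' := by
  induction j using Nat.strong_induction_on generalizing x with
  | _ j ih =>
    by_cases hl : Legal p x j
    · exact ⟨x, j, hxj, le_rfl, hl⟩
    · simp only [Legal, not_and, not_forall] at hl
      obtain ⟨x', j', hle, hlt, hv⟩ := hl h
      obtain ⟨a, b, hab, hb, hl⟩ := ih j' hlt hle hv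
      exact ⟨a, b, hab, hb.trans hlt.le, hl⟩

theorem exists_legal (p : List (Round P)) :
    ∃ I : NonemptyInterval ℕ, Legal p I.fst I.snd := by
  obtain ⟨x, hx⟩ := exists_not_visited p
  obtain ⟨a, b, hab, -, hl⟩ := exists_legal_le le_rfl hx
  exact ⟨⟨(a, b), hab⟩, hl⟩

theorem finite_legal (p : List (Round P)) :
    {I : NonemptyInterval ℕ | Legal p I.fst I.snd}.Finite := by
  obtain ⟨x, hx⟩ := exists_not_visited p
  refine (rows (x + 1)).finite_toSet.subset fun I hI => ?_
  refine Finset.mem_coe.2 (mem_rows.2 ?_)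
  by_contra hlt
  exact hx (hI.2 x x le_rfl (by omega))

theorem isPrefix_map_range {α : Type*} (f : ℕ → α) {k n : ℕ} (h : k ≤ n) :
    (List.range k).map f <+: (List.range n).map f := by
  obtain ⟨d, rfl⟩ := Nat.exists_eq_add_of_le h
  rw [List.range_add, List.map_append]
  exact List.prefix_append _ _

/-- A legal interval always exists, so the play can be continued forever with empty labels; the
sequence is read off from the increasing chain of prefixes. -/
theorem IsPlay.exists_infinite (h : IsPlay φ S p) :
    ∃ Q : ℕ → Round P, (∀ n, IsPlay φ S ((List.range n).map Q)) ∧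
      (List.range p.length).map Q = p := by
  choose next hnext using fun p : List (Round P) => exists_legal p
  let step : List (Round P) → List (Round P) := fun p => p ++ [⟨next p, ∅, ∅⟩]
  let seq : ℕ → List (Round P) := fun k => step^[k] p
  have hsucc : ∀ k, seq (k + 1) = seq k ++ [⟨next (seq k), ∅, ∅⟩] :=
    fun k => Function.iterate_succ_apply' step k p
  have hplay : ∀ k, IsPlay φ S (seq k) := by
    intro k
    induction k with
    | zero => exact h
    | succ k ih =>
      rw [hsucc]
      exact isPlay_concat.2 ⟨ih, hnext _, Set.empty_subset _, Set.empty_subset _⟩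
  have hlen : ∀ k, (seq k).length = p.length + k := by
    intro k
    induction k with
    | zero => rfl
    | succ k ih => rw [hsucc, List.length_append, ih]; rfl
  have hpre : ∀ k n, k ≤ n → seq k <+: seq n := by
    intro k n hkn
    induction n, hkn using Nat.le_induction with
    | base => exact List.prefix_refl _
    | succ n _ ih =>
      rw [hsucc]
      exact ih.trans (List.prefix_append _ _)
  let Q : ℕ → Round P := fun i => ((seq (i + 1))[i]?).getD default
  have hQ : ∀ k i, i < (seq k).length → (seq k)[i]? = some (Q i) := by
    intro k i hi
    have hi' : i < (seq (i + 1)).length := by rw [hlen]; omega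
    have : (seq k)[i] = (seq (i + 1))[i] := by
      rcases le_total k (i + 1) with hle | hle
      · exact (hpre _ _ hle).getElem hi
      · exact ((hpre _ _ hle).getElem hi').symm
    simp only [Q, List.getElem?_eq_getElem hi, List.getElem?_eq_getElem hi', Option.getD_some, this]
  have heq : ∀ k, (List.range (seq k).length).map Q = seq k := by
    intro k
    refine List.ext_getElem? fun i => ?_
    by_cases hi : i < (seq k).length
    · rw [hQ k i hi]
      simp [hi]
    · simp [hi]
  refine ⟨Q, fun n => ?_, heq 0⟩
  refine (hplay n).of_prefix ?_
  rw [← heq n]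
  exact isPrefix_map_range Q (by rw [hlen]; omega)

theorem isSpoilerRun_of_isPlay {Q : ℕ → Round P}
    (h : ∀ n, IsPlay φ S ((List.range n).map Q)) : IsSpoilerRun φ S fun i => (Q i).move := by
  classical
  have hQ : ∀ k, Legal ((List.range k).map Q) (Q k).interval.fst (Q k).interval.snd ∧
      (Q k).spoiler ⊆ S ∧ (Q k).duplicator ⊆ sigmaT φ \ S := by
    intro k
    have := h (k + 1)
    rw [List.range_succ, List.map_append] at this
    exact (isPlay_concat.1 this).2
  have hv : ∀ k (I : NonemptyInterval ℕ), Visited ((List.range k).map Q) I.fst I.snd ↔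
      ∃ l < k, (Q l).interval = I := by
    intro k I
    rw [visited_iff_mem]
    simp
  refine ⟨fun i => ((Q (i / 2)).interval,
    if i % 2 = 0 then (Q (i / 2)).spoiler else (Q (i / 2)).duplicator), ⟨?_, ?_⟩, ?_⟩
  · intro I
    by_contra hI
    have hnv : ∀ k, (Q k).interval ≠ I := by
      intro k hk
      refine hI ⟨2 * k, ?_⟩
      rw [Nat.mul_div_cancel_left _ two_pos]
      exact hk
    -- If `I` is never chosen, legality confines all rounds to the rows up to that of `I`; one round
    -- more than there are intervals in these rows contradicts distinctness.
    have hsub : ((List.range ((rows (I.snd + 1)).card + 1)).map Q |>.map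
        Round.interval).toFinset ⊆ rows (I.snd + 1) := by
      intro J hJ
      simp only [List.map_map, List.mem_toFinset, List.mem_map, Function.comp] at hJ
      obtain ⟨k, -, rfl⟩ := hJ
      rw [mem_rows]
      by_contra hlt
      obtain ⟨l, -, hl⟩ := (hv k I).1 ((hQ k).1.2 _ _ I.fst_le_snd (by omega))
      exact hnv l hl
    have hc := Finset.card_le_card hsub
    rw [List.toFinset_card_of_nodup (h _).nodup] at hc
    simp at hc
  · refine RunRules.of_legal (q := fun k => some (Q k)) fun k r hr => ?_
    cases hr
    refine ⟨(hQ k).2.1, (hQ k).2.2, ?_, ?_⟩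
    · rintro l hl t ht heq
      cases ht
      exact (hQ k).1.1 ((hv k _).2 ⟨l, hl, heq⟩)
    · intro I hI
      obtain ⟨l, hl, heq⟩ := (hv k I).1 ((hQ k).1.2 _ _ I.fst_le_snd hI)
      exact ⟨l, hl, _, rfl, heq⟩
  · intro i
    simp [Round.move]

/-- Any legal move of Spoiler after a play belongs to a Spoiler sequence. -/
theorem IsPlay.exists_isSpoilerRun (h : IsPlay φ S p) {I : NonemptyInterval ℕ}
    (hI : Legal p I.fst I.snd) {σ : Set (Formula P)} (hσ : σ ⊆ S) :
    ∃ s, IsSpoilerRun φ S s ∧ p.map Round.move = (List.range p.length).map s ∧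
      s p.length = (I, σ) := by
  have h' : IsPlay φ S (p ++ [⟨I, σ, ∅⟩]) :=
    isPlay_concat.2 ⟨h, hI, hσ, Set.empty_subset _⟩
  obtain ⟨Q, hQ, heq⟩ := h'.exists_infinite
  rw [List.length_append, List.length_singleton, List.range_succ, List.map_append] at heq
  obtain ⟨h₁, h₂⟩ := List.append_inj' heq rfl
  refine ⟨_, isSpoilerRun_of_isPlay hQ, ?_, ?_⟩
  · conv_lhs => rw [← h₁]
    rw [List.map_map]
    rfl
  · have : Q p.length = ⟨I, σ, ∅⟩ := by simpa using h₂
    simp only [this]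
    rfl

/-- The step rule speaks only of changes of row, so completeness of the lower rows is carried by
induction through moves within a row. Legality depends on the chosen intervals alone, so
Duplicator's answers in `p` may differ from those of the run behind `s`. -/
theorem IsSpoilerRun.legal {s : ℕ → Move P} (h : IsSpoilerRun φ S s) {n : ℕ}
    (hp : p.map Round.move = (List.range n).map s) :
    Legal p (s n).1.fst (s n).1.snd ∧ (s n).2 ⊆ S := by
  obtain ⟨ρ, hρ, hs⟩ := h
  have hlow : ∀ k, ∀ I : NonemptyInterval ℕ, I.snd < (s k).1.snd → ∃ l < k, (s l).1 = I := by
    intro k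
    induction k with
    | zero =>
      intro I hI
      rw [hs, (hρ.rules.start _ rfl).2] at hI
      omega
    | succ k ih =>
      intro I hI
      have ha := (hρ.rules.answer (2 * k) _ _ (even_two_mul k) rfl rfl).1
      by_cases heq : (s (k + 1)).1.snd = (s k).1.snd
      · obtain ⟨l, hl, hl'⟩ := ih I (heq ▸ hI)
        exact ⟨l, by omega, hl'⟩
      · rw [hs, hs] at heq
        have hst := (hρ.rules.step (2 * k + 1) _ _ rfl rfl (by rw [← ha]; exact heq)).2 I
          (by rw [hs] at hI; exact hI)
        obtain ⟨j, hj, u, hu, rfl⟩ := hst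
        cases hu
        refine ⟨j / 2, by omega, ?_⟩
        rw [hs]
        rcases Nat.even_or_odd' j with ⟨c, rfl | rfl⟩
        · rw [Nat.mul_div_cancel_left _ two_pos]
        · rw [show (2 * c + 1) / 2 = c by omega]
          exact (hρ.rules.answer (2 * c) _ _ (even_two_mul c) rfl rfl).1
  have hv : ∀ I : NonemptyInterval ℕ, Visited p I.fst I.snd ↔ ∃ l < n, (s l).1 = I := by
    intro I
    have : I ∈ (p.map Round.move).map Prod.fst ↔ I ∈ ((List.range n).map s).map Prod.fst := by
      rw [hp]
    rw [visited_iff_mem]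
    simpa [Round.move] using this
  refine ⟨⟨?_, ?_⟩, ?_⟩
  · rw [hv]
    rintro ⟨l, hl, heq⟩
    rw [hs, hs] at heq
    exact hρ.rules.once (2 * n) (2 * l) _ _ (even_two_mul n) (by omega) (by omega) rfl rfl heq.symm
  · intro x j hxj hj
    exact (hv ⟨(x, j), hxj⟩).2 (hlow n _ hj)
  · rw [hs]
    exact (hρ.rules.answer (2 * n) _ _ (even_two_mul n) rfl rfl).2.1

end Plays

/-! ### The game, and winning it by means of a response tree -/

/-- Duplicator can force a successful run within `n` further rounds. -/
def WinIn (φ : Formula P) (S : Set (Formula P)) : ℕ → List (Round P) → Prop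
  | 0, p => IsSuccessful φ S (unroll p)
  | n + 1, p => IsSuccessful φ S (unroll p) ∨
      ∀ (I : NonemptyInterval ℕ) (σ : Set (Formula P)), Legal p I.fst I.snd → σ ⊆ S →
        ∃ δ ⊆ sigmaT φ \ S, WinIn φ S n (p ++ [⟨I, σ, δ⟩])

section Game

variable {φ : Formula P} {S : Set (Formula P)} {p q : List (Round P)} {r : Round P} {n : ℕ}

theorem WinIn.of_isSuccessful (h : IsSuccessful φ S (unroll p)) : WinIn φ S n p := by
  cases n
  · exact h
  · exact Or.inl h

theorem WinIn.succ (h : WinIn φ S n p) : WinIn φ S (n + 1) p := by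
  induction n generalizing p with
  | zero => exact Or.inl h
  | succ n ih =>
    refine h.imp_right fun h I σ hI hσ => ?_
    obtain ⟨δ, hδ, hw⟩ := h I σ hI hσ
    exact ⟨δ, hδ, ih hw⟩

end Game

namespace LabelledTree

variable {T : LabelledTree P}

variable (T) in
/-- The rounds along the path that starts in a node and goes on through a list. -/
def rounds : T.V → List T.V → List (Round P)
  | _, [] => []
  | u, v :: vs => ⟨(T.edgeLabel u v).1, (T.edgeLabel u v).2, T.nodeLabel v⟩ :: rounds v vs

theorem unroll_rounds (u : T.V) (vs : List T.V) : unroll (T.rounds u vs) = T.pathRun u vs := by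
  induction vs generalizing u with
  | nil => rfl
  | cons v vs ih =>
    change _ :: _ :: unroll (T.rounds v vs) = _
    rw [ih]
    rfl

theorem map_move_rounds (u : T.V) (vs : List T.V) :
    (T.rounds u vs).map Round.move = T.edgeLabels u vs := by
  induction vs generalizing u with
  | nil => rfl
  | cons v vs ih =>
    rw [rounds, List.map_cons, ih]
    rfl

theorem length_rounds (u : T.V) (vs : List T.V) : (T.rounds u vs).length = vs.length := by
  induction vs generalizing u with
  | nil => rfl
  | cons v vs ih => rw [rounds, List.length_cons, ih, List.length_cons]

theorem rounds_concat (u w : T.V) (vs : List T.V) :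
    T.rounds u (vs ++ [w]) = T.rounds u vs ++
      [⟨(T.edgeLabel ((u :: vs).getLast (List.cons_ne_nil _ _)) w).1,
        (T.edgeLabel ((u :: vs).getLast (List.cons_ne_nil _ _)) w).2, T.nodeLabel w⟩] := by
  induction vs generalizing u with
  | nil => rfl
  | cons v vs ih =>
    rw [List.cons_append, rounds, ih, rounds, List.cons_append]
    rfl

/-- Since parents are unique, a cycle through a node also passes through its parent, and so back to
the root, which has no parent. -/
theorem not_transGen_self (v : T.V) : ¬ Relation.TransGen T.E v v := by
  induction T.reachable v with
  | refl =>
    intro h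
    obtain ⟨w, -, hw⟩ := Relation.TransGen.tail'_iff.1 h
    exact T.not_edge_root w hw
  | tail _ huv ih =>
    intro h
    obtain ⟨w, hw, hwv⟩ := Relation.TransGen.tail'_iff.1 h
    rw [T.parent_unique _ _ _ hwv huv] at hw
    exact ih (Relation.TransGen.head' huv hw)

theorem isChain_concat {u w : T.V} {vs : List T.V} (h : List.IsChain T.E (u :: vs))
    (hw : T.E ((u :: vs).getLast (List.cons_ne_nil _ _)) w) :
    List.IsChain T.E (u :: (vs ++ [w])) := by
  rw [← List.cons_append, List.isChain_append]
  refine ⟨h, List.isChain_singleton _, ?_⟩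
  intro a ha b hb
  rw [List.getLast?_eq_getLast_of_ne_nil (List.cons_ne_nil _ _)] at ha
  cases ha
  cases hb
  exact hw

theorem length_le_card_of_isChain {vs : List T.V} (h : List.IsChain T.E vs) :
    vs.length ≤ Nat.card T.V := by
  have := T.finite
  have := Fintype.ofFinite T.V
  have h' : List.IsChain (Relation.TransGen T.E) vs :=
    h.imp fun _ _ h => Relation.TransGen.single h
  have hnd : vs.Nodup := (List.isChain_iff_pairwise.1 h').imp fun h heq => by
    subst heq
    exact not_transGen_self _ h
  rw [Nat.card_eq_fintype_card]
  exact hnd.length_le_card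

/-- Edges out of a node are determined by their labels, so two paths labelled along the same
sequence agree as long as both last. The path `ws` ends in a leaf and `vs` does not, hence `ws`
properly extends `vs` and its next edge is the one wanted. -/
theorem IsResponseTree.exists_child {φ : Formula P} {S : Set (Formula P)}
    (hT : T.IsResponseTree φ S) {u : T.V} {vs ws : List T.V} {s : ℕ → Move P}
    (hvs : List.IsChain T.E (u :: vs)) (hws : List.IsChain T.E (u :: ws))
    (hleaf : ∀ w, ¬ T.E ((u :: ws).getLast (List.cons_ne_nil _ _)) w)
    (hvlab : T.edgeLabels u vs = (List.range vs.length).map s)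
    (hwlab : T.edgeLabels u ws = (List.range ws.length).map s)
    (hinner : ∃ w, T.E ((u :: vs).getLast (List.cons_ne_nil _ _)) w) :
    ∃ w, T.E ((u :: vs).getLast (List.cons_ne_nil _ _)) w ∧
      T.edgeLabel ((u :: vs).getLast (List.cons_ne_nil _ _)) w = s vs.length := by
  induction vs generalizing u ws s with
  | nil =>
    cases ws with
    | nil => exact absurd hinner (by simpa using hleaf)
    | cons w ws =>
      rw [edgeLabels, List.length_cons, List.range_succ_eq_map, List.map_cons,
        List.cons.injEq] at hwlab
      exact ⟨w, (List.isChain_cons_cons.1 hws).1, hwlab.1⟩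
  | cons v vs ih =>
    obtain ⟨huv, hvs⟩ := List.isChain_cons_cons.1 hvs
    cases ws with
    | nil => exact absurd huv (hleaf v)
    | cons w ws =>
      obtain ⟨huw, hws⟩ := List.isChain_cons_cons.1 hws
      rw [edgeLabels, List.length_cons, List.range_succ_eq_map, List.map_cons, List.map_map,
        List.cons.injEq] at hwlab hvlab
      obtain rfl := hT.deterministic _ _ _ huv huw (hvlab.1.trans hwlab.1.symm)
      exact ih hvs hws hleaf hvlab.2 hwlab.2 hinner

/-- The budget `n` is what the number of nodes leaves for the rest of the path: paths do not repeat
nodes, so with budget zero the path has reached a leaf. -/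
theorem IsResponseTree.winIn {φ : Formula P} {S : Set (Formula P)}
    (hT : T.IsResponseTree φ S) (n : ℕ) (vs : List T.V)
    (hvs : List.IsChain T.E (T.root :: vs)) (hplay : IsPlay φ S (T.rounds T.root vs))
    (hn : Nat.card T.V ≤ vs.length + 1 + n) : WinIn φ S n (T.rounds T.root vs) := by
  induction n generalizing vs with
  | zero =>
    have hleaf : T.IsRootToLeaf vs := by
      refine ⟨hvs, fun w hw => ?_⟩
      have hc : List.IsChain T.E (T.root :: (vs ++ [w])) := isChain_concat hvs hw
      have := length_le_card_of_isChain hc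
      simp at this
      omega
    rw [WinIn, unroll_rounds]
    exact hT.successful _ ⟨vs, hleaf, rfl⟩
  | succ n ih =>
    by_cases hleaf : T.IsRootToLeaf vs
    · refine WinIn.of_isSuccessful ?_
      rw [unroll_rounds]
      exact hT.successful _ ⟨vs, hleaf, rfl⟩
    · refine Or.inr fun I σ hI hσ => ?_
      have hinner : ∃ w, T.E ((T.root :: vs).getLast (List.cons_ne_nil _ _)) w := by
        by_contra! h
        exact hleaf ⟨hvs, h⟩
      -- Completeness of the tree concerns infinite sequences only, so the single move is first
      -- embedded in one.
      obtain ⟨s, hs, hmove, hsI⟩ := hplay.exists_isSpoilerRun hI hσ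
      rw [map_move_rounds, length_rounds] at hmove
      rw [length_rounds] at hsI
      obtain ⟨ws, hws, hwlab⟩ := hT.complete s hs
      obtain ⟨w, hw, hwl⟩ := hT.exists_child hvs hws.1 hws.2 hmove hwlab hinner
      have hc : List.IsChain T.E (T.root :: (vs ++ [w])) := isChain_concat hvs hw
      have hr := rounds_concat T.root w vs
      rw [hwl, hsI] at hr
      refine ⟨T.nodeLabel w, hT.nodeLabel_subset w, ?_⟩
      rw [← hr]
      refine ih (vs ++ [w]) hc ?_ ?_
      · rw [hr]
        exact isPlay_concat.2 ⟨hplay, hI, hσ, hT.nodeLabel_subset w⟩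
      · rw [List.length_append, List.length_singleton]
        omega

end LabelledTree

/-! ### Imitating a longer play by a shorter one -/

/-- The position `q` arises from `q'` by removing the rows `y + 1, …, y + d` and the columns
outside the range of `embed f y d`. The position `p` contains the first rows of `q'`. -/
structure Simulates (φ : Formula P) (S : Set (Formula P)) (f : ℕ → ℕ) (y d : ℕ)
    (p q q' : List (Round P)) : Prop where
  play : IsPlay φ S q
  play' : IsPlay φ S q'
  isPrefix : p <+: q'
  low : ∀ x j, x ≤ j → j ≤ y → Visited q x j ∧ label q x j = label p x j
  high : ∀ x j, x ≤ j → y < j → (Visited q x j ↔ Visited q' (embed f y d x) (j + d)) ∧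
    label q x j = label q' (embed f y d x) (j + d)

/-- The points up to `y` can be sent to points up to `y + d` such that row `y` recurs in row
`y + d` and the classes are respected. -/
structure RowEmbedding (f : ℕ → ℕ) (y d : ℕ) (L : ℕ → ℕ → Set (Formula P)) : Prop where
  le : ∀ x ≤ y, f x ≤ y + d
  inj : ∀ x ≤ y, ∀ x' ≤ y, f x = f x' → x = x'
  label_eq : ∀ x ≤ y, L x y = L (f x) (y + d)
  sim_iff : ∀ x x', x ≤ x' → x' ≤ y →
    (Formula.sim ∈ L x x' ↔ Formula.sim ∈ L (min (f x) (f x')) (max (f x) (f x')))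

section Simulation

variable {φ : Formula P} {S : Set (Formula P)} {p q q' : List (Round P)} {f : ℕ → ℕ} {y d : ℕ}

theorem RowEmbedding.embed_le {L : ℕ → ℕ → Set (Formula P)} (hf : RowEmbedding f y d L)
    {x j : ℕ} (hx : x ≤ j) (hj : y ≤ j) : embed f y d x ≤ j + d := by
  unfold embed
  split_ifs with h
  · have := hf.le x h
    omega
  · omega

theorem RowEmbedding.embed_injective {L : ℕ → ℕ → Set (Formula P)} (hf : RowEmbedding f y d L)
    {x x' : ℕ} (h : embed f y d x = embed f y d x') : x = x' := by
  unfold embed at h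
  split_ifs at h with h₁ h₂ h₂
  · exact hf.inj x h₁ x' h₂ h
  · have := hf.le x h₁
    omega
  · have := hf.le x' h₂
    omega
  · omega

theorem Simulates.isSuccessful (h : Simulates φ S f y d p q q')
    (hp : VisitsRows p (y + d + 1)) (hf : RowEmbedding f y d (label p))
    (hs : IsSuccessful φ S (unroll q')) : IsSuccessful φ S (unroll q) := by
  obtain ⟨m', hm', hv, hc⟩ := h.play'.isSuccessful_iff.1 hs
  have hpv : ∀ x j, x ≤ j → j ≤ y + d → Visited p x j :=
    fun x j hxj hj => (hp x j hxj).2 (by omega)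
  have hlab : ∀ x j, x ≤ j → j ≤ y + d → label q' x j = label p x j :=
    fun x j hxj hj => h.play'.label_eq h.isPrefix (hpv x j hxj hj)
  have hy : y + d < m' := (hv _ _ le_rfl).1 ((hpv (y + d) (y + d) le_rfl le_rfl).mono h.isPrefix)
  obtain ⟨m, rfl⟩ : ∃ m, m' = m + d := ⟨m' - d, by omega⟩
  refine h.play.isSuccessful_iff.2 ⟨m, by omega, ?_, ?_⟩
  · intro x j hxj
    by_cases hj : j ≤ y
    · exact iff_of_true (h.low x j hxj hj).1 (by omega)
    · rw [(h.high x j hxj (by omega)).1, hv _ _ (hf.embed_le hxj (by omega))]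
      omega
  · refine hc.contract (f := f) (y := y) (by omega) hf.le ?_ ?_ ?_ ?_
    · intro x hx
      rw [hlab x y hx (by omega), hlab _ _ (hf.le x hx) le_rfl, hf.label_eq x hx]
    · intro x x' hxx' hx'
      rw [hlab x x' hxx' (by omega), hlab _ _ min_le_max
        (max_le (hf.le x (hxx'.trans hx')) (hf.le x' hx')), hf.sim_iff x x' hxx' hx']
    · intro x j hxj hj
      rw [(h.low x j hxj hj).2, hlab x j hxj (by omega)]
    · intro x j hxj hj _
      exact (h.high x j hxj hj).2

/-- A round in a column outside the range of `embed` leaves no trace in `q`. -/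
theorem Simulates.concat_right (h : Simulates φ S f y d p q q') {r : Round P}
    (hr : ∀ x, embed f y d x ≠ r.interval.fst) (hplay : IsPlay φ S (q' ++ [r])) :
    Simulates φ S f y d p q (q' ++ [r]) := by
  refine ⟨h.play, hplay, h.isPrefix.trans (List.prefix_append _ _), h.low, ?_⟩
  intro x j hxj hj
  have hne : ¬ (r.interval.fst = embed f y d x ∧ r.interval.snd = j + d) :=
    fun h => hr x h.1.symm
  rw [visited_concat, label_concat hne, or_iff_left hne]
  exact h.high x j hxj hj

theorem Simulates.concat (h : Simulates φ S f y d p q q') (hf : RowEmbedding f y d (label p))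
    {r r' : Round P}
    (hplay : IsPlay φ S (q ++ [r])) (hplay' : IsPlay φ S (q' ++ [r'])) (hy : y < r.interval.snd)
    (hfst : r'.interval.fst = embed f y d r.interval.fst)
    (hsnd : r'.interval.snd = r.interval.snd + d)
    (hs : r'.spoiler = r.spoiler) (hd : r'.duplicator = r.duplicator) :
    Simulates φ S f y d p (q ++ [r]) (q' ++ [r']) := by
  refine ⟨hplay, hplay', h.isPrefix.trans (List.prefix_append _ _), ?_, ?_⟩
  · intro x j hxj hj
    obtain ⟨h₁, h₂⟩ := h.low x j hxj hj
    refine ⟨h₁.mono (List.prefix_append _ _), ?_⟩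
    rw [label_concat (by omega), h₂]
  · intro x j hxj hj
    obtain ⟨h₁, h₂⟩ := h.high x j hxj hj
    have hiff : (r.interval.fst = x ∧ r.interval.snd = j) ↔
        (r'.interval.fst = embed f y d x ∧ r'.interval.snd = j + d) := by
      rw [hfst, hsnd, Nat.add_right_cancel_iff]
      exact and_congr_left fun _ => ⟨fun h => by rw [h], hf.embed_injective⟩
    rw [visited_concat, visited_concat, h₁, hiff]
    refine ⟨Iff.rfl, ?_⟩
    by_cases heq : r.interval.fst = x ∧ r.interval.snd = j
    · obtain ⟨rfl, rfl⟩ := heq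
      rw [label_concat_self (isPlay_concat.1 hplay).2.1.1, ← hfst, ← hsnd,
        label_concat_self (isPlay_concat.1 hplay').2.1.1, hs, hd]
    · rw [label_concat heq, label_concat (hiff.not.1 heq), h₂]

/-- By `hextra`, all legal moves of the shadow play `q'` lie in surviving columns. If the translated
move were blocked, a lowest blocking interval would be legal in `q'`, hence the translate of an
interval below row `j` that `q` has visited; so it would be visited after all. -/
theorem Simulates.legal (h : Simulates φ S f y d p q q') (hp : VisitsRows p (y + d + 1))
    (hextra : ∀ x j, x ≤ j → Legal q' x j → ∃ x', embed f y d x' = x)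
    {x j : ℕ} (hxj : x ≤ j) (hl : Legal q x j) :
    y < j ∧ Legal q' (embed f y d x) (j + d) := by
  have hy : y < j := by
    by_contra hj
    exact hl.1 (h.low x j hxj (by omega)).1
  refine ⟨hy, fun hv => hl.1 ((h.high x j hxj hy).1.2 hv), ?_⟩
  intro x' j' hxj' hj'
  by_contra hv
  obtain ⟨a, b, hab, hb, hl'⟩ := exists_legal_le hxj' hv
  obtain ⟨z, rfl⟩ := hextra a b hab hl'
  have hyb : y + d < b := by
    by_contra hyb
    exact hl'.1 (((hp _ _ hab).2 (by omega)).mono h.isPrefix)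
  obtain ⟨k, rfl⟩ : ∃ k, b = k + d := ⟨b - d, by omega⟩
  have hzk : z ≤ k := by
    unfold embed at hab
    split_ifs at hab <;> omega
  exact hl'.1 ((h.high z k hzk (by omega)).1.1 (hl.2 z k hzk (by omega)))

/-- While `q'` has a legal interval in a deleted column, that interval is played there and `q`
stands still. Otherwise Spoiler's move in `q` is translated and the answer copied. The budget counts
rounds of `q'`, so the pauses of `q` do not increase it. -/
theorem WinIn.of_simulates {n : ℕ} (hp : VisitsRows p (y + d + 1))
    (hf : RowEmbedding f y d (label p)) (h : Simulates φ S f y d p q q')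
    (hw : WinIn φ S n q') : WinIn φ S n q := by
  induction n generalizing q q' with
  | zero => exact h.isSuccessful hp hf hw
  | succ n ih =>
    rcases hw with hw | hw
    · exact Or.inl (h.isSuccessful hp hf hw)
    · by_cases hextra : ∀ x j, x ≤ j → Legal q' x j → ∃ x', embed f y d x' = x
      · refine Or.inr fun I σ hI hσ => ?_
        obtain ⟨hy, hl⟩ := h.legal hp hextra I.fst_le_snd hI
        obtain ⟨δ, hδ, hw'⟩ :=
          hw ⟨(embed f y d I.fst, I.snd + d), hf.embed_le I.fst_le_snd hy.le⟩ σ hl hσ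
        refine ⟨δ, hδ, ih ?_ hw'⟩
        exact h.concat hf (isPlay_concat.2 ⟨h.play, hI, hσ, hδ⟩)
          (isPlay_concat.2 ⟨h.play', hl, hσ, hδ⟩) hy rfl rfl rfl rfl
      · push Not at hextra
        obtain ⟨x, j, hxj, hl, hne⟩ := hextra
        -- Any subset of `S` would serve as Spoiler's label here; `q` never sees it.
        obtain ⟨δ, hδ, hw'⟩ := hw ⟨(x, j), hxj⟩ ∅ hl (Set.empty_subset _)
        exact (ih (h.concat_right hne
          (isPlay_concat.2 ⟨h.play', hl, Set.empty_subset _, hδ⟩)) hw').succ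

end Simulation

/-! ### From comparable collections to row embeddings -/

-- An injective multiset function relates values, not indices. The indices of `s` are treated one by
-- one, and each uses up one index of `t` with the prescribed value.
open Classical in
theorem exists_injOn_of_multiset {α β ι κ : Type*} [Nonempty κ] {R : α → β → Prop}
    {s : Finset ι} {t : Finset κ} {a : ι → α} {b : κ → β} {g : Multiset (α × β)}
    (h₁ : g.map Prod.fst = s.val.map a) (h₂ : g.map Prod.snd ≤ t.val.map b)
    (h₃ : ∀ p ∈ g, R p.1 p.2) :
    ∃ f : ι → κ, (∀ x ∈ s, f x ∈ t ∧ R (a x) (b (f x))) ∧ Set.InjOn f s := by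
  induction s using Finset.induction_on generalizing t g with
  | empty => exact ⟨fun _ => Classical.arbitrary κ, by simp, by simp⟩
  | insert x s hx ih =>
    rw [Finset.insert_val_of_notMem hx, Multiset.map_cons] at h₁
    have hmem : a x ∈ g.map Prod.fst := h₁ ▸ Multiset.mem_cons_self _ _
    obtain ⟨p, hp, hpa⟩ := Multiset.mem_map.1 hmem
    obtain ⟨g, rfl⟩ := Multiset.exists_cons_of_mem hp
    rw [Multiset.map_cons, hpa, Multiset.cons_inj_right] at h₁
    rw [Multiset.map_cons] at h₂
    obtain ⟨z, hz, hzp⟩ := Multiset.mem_map.1 (Multiset.mem_of_le h₂ (Multiset.mem_cons_self _ _))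
    rw [Finset.mem_val] at hz
    rw [← Finset.insert_erase hz, Finset.insert_val_of_notMem (Finset.notMem_erase z t),
      Multiset.map_cons, hzp, Multiset.cons_le_cons_iff] at h₂
    obtain ⟨f, hf, hinj⟩ := ih h₁ h₂ fun p hp => h₃ p (Multiset.mem_cons_of_mem hp)
    have hne : ∀ w ∈ s, w ≠ x := fun w hw h => hx (h ▸ hw)
    have hupd : ∀ w ∈ s, Function.update f x z w = f w :=
      fun w hw => Function.update_of_ne (hne w hw) _ _
    refine ⟨Function.update f x z, ?_, ?_⟩
    · intro w hw
      rcases Finset.mem_insert.1 hw with rfl | hw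
      · rw [Function.update_self]
        refine ⟨hz, ?_⟩
        rw [← hpa, hzp]
        exact h₃ p hp
      · rw [hupd w hw]
        exact ⟨Finset.mem_of_mem_erase (hf w hw).1, (hf w hw).2⟩
    · rw [Finset.coe_insert, Set.injOn_insert (by simpa using hx)]
      refine ⟨hinj.congr fun w hw => (hupd w hw).symm, ?_⟩
      rintro ⟨w, hw, heq⟩
      rw [Function.update_self, hupd w hw] at heq
      exact Finset.ne_of_mem_erase (hf w hw).1 heq

theorem exists_injOn_of_map_le {α ι κ : Type*} [Nonempty κ] {s : Finset ι} {t : Finset κ}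
    {a : ι → α} {b : κ → α} (h : s.val.map a ≤ t.val.map b) :
    ∃ f : ι → κ, (∀ x ∈ s, f x ∈ t ∧ a x = b (f x)) ∧ Set.InjOn f s := by
  refine exists_injOn_of_multiset (R := Eq) (g := (s.val.map a).map fun x => (x, x)) ?_ ?_ ?_
  · simp
  · simpa using h
  · simp only [Multiset.mem_map]
    rintro _ ⟨x, -, rfl⟩
    rfl

open Classical in
/-- If `𝓜(y) ≤ 𝓜(y')`, then the points up to `y` can be sent to points up to `y'` such that row `y`
recurs in row `y'` and the classes are respected. -/
theorem exists_injOn_of_collectionLE {D : Type*} [LinearOrder D] [Fintype D]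
    {τ : D → D → Set (Formula P)} {r : Setoid D} (hr : ∀ x x', x' ∈ simClass τ x ↔ r x' x)
    {y y' : D} (h : CollectionLE (collection τ y) (collection τ y')) :
    ∃ f : D → D, (∀ x ≤ y, f x ≤ y' ∧ τ x y = τ (f x) y') ∧
      (∀ x ≤ y, ∀ x' ≤ y, f x = f x' → x = x') ∧
      ∀ x ≤ y, ∀ x' ≤ y, (r x x' ↔ r (f x) (f x')) := by
  have : Nonempty D := ⟨y⟩
  have hclass : ∀ x x', simClass τ x = simClass τ x' ↔ r x x' := by
    intro x x'
    constructor
    · intro heq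
      rw [← hr, ← heq, hr]
    · intro hxx'
      ext z
      rw [hr, hr]
      exact ⟨fun h => r.trans h hxx', fun h => r.trans h (r.symm hxx')⟩
  obtain ⟨g, hg₁, hg₂, hg₃⟩ := h
  -- The comparison is realised on two levels: `H` matches classes with classes, and `k` below
  -- matches points inside each matched pair.
  obtain ⟨H, hH, hHinj⟩ := exists_injOn_of_multiset (R := (· ≤ ·)) hg₁ hg₂ hg₃
  have hk : ∀ c ∈ (Finset.univ.filter fun x => x ≤ y).image (simClass τ), ∃ k : D → D,
      (∀ x ∈ c.filter fun x => x ≤ y, k x ∈ ((H c).filter fun x => x ≤ y') ∧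
        τ x y = τ (k x) y') ∧ Set.InjOn k (c.filter fun x => x ≤ y) :=
    fun c hc => exists_injOn_of_map_le (hH c hc).2
  choose! k hk hkinj using hk
  have hc : ∀ x ≤ y, simClass τ x ∈ (Finset.univ.filter fun x => x ≤ y).image (simClass τ) :=
    fun x hx => Finset.mem_image_of_mem _ (by simpa using hx)
  have hself : ∀ x ≤ y, x ∈ (simClass τ x).filter fun x => x ≤ y :=
    fun x hx => Finset.mem_filter.2 ⟨(hr x x).2 (r.refl x), hx⟩
  let f : D → D := fun x => k (simClass τ x) x
  have hf := fun x hx => hk _ (hc x hx) x (hself x hx)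
  have hfc : ∀ x ≤ y, simClass τ (f x) = H (simClass τ x) := by
    intro x hx
    obtain ⟨z, -, hz⟩ := Finset.mem_image.1 (hH _ (hc x hx)).1
    have := (Finset.mem_filter.1 (hf x hx).1).1
    rw [← hz, hr, ← hclass] at this
    rw [← hz]
    exact this
  -- Injectivity of `H` is what keeps inequivalent points inequivalent.
  have hrel : ∀ x ≤ y, ∀ x' ≤ y, (r x x' ↔ r (f x) (f x')) := by
    intro x hx x' hx'
    rw [← hclass, ← hclass, hfc x hx, hfc x' hx']
    exact (hHinj.eq_iff (hc x hx) (hc x' hx')).symm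
  refine ⟨f, fun x hx => ⟨(Finset.mem_filter.1 (hf x hx).1).2, (hf x hx).2⟩, ?_, hrel⟩
  intro x hx x' hx' heq
  have hxx' : r x x' := by
    rw [hrel x hx x' hx', heq]
  have hcc := (hclass x x').2 hxx'
  refine hkinj _ (hc x hx) (hself x hx) (by rw [hcc]; exact hself x' hx') ?_
  change f x = _
  rw [heq, hcc]

section Labels

variable {φ : Formula P} {S : Set (Formula P)} {m : ℕ} {L : ℕ → ℕ → Set (Formula P)}

theorem LabelsSuccessful.sat_iff_mem (h : LabelsSuccessful φ m L) {ψ : Formula P}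
    (hψ : ψ ∈ sigmaT φ) (I : NonemptyInterval (Fin m)) :
    Sat (labelVal m L) ψ I ↔ ψ ∈ L I.fst.val I.snd.val := by
  rcases hψ with hψ | hψ
  · rw [h.sat_iff (letters_subset_closure φ hψ)]
    obtain ⟨-, a, rfl⟩ := hψ
    rfl
  · exact h.2.2 I ψ hψ

theorem sigmaT_subset_extClosure (φ : Formula P) : sigmaT φ ⊆ extClosure φ :=
  Set.union_subset (fun _ h => Or.inl (letters_subset_closure φ h)) fun _ h => h.1

/-- In a successful structure a label is the part of the type that lies in `sigmaT φ`; `hL` excludes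
stray formulas that the type would not record. -/
theorem LabelsSuccessful.label_eq_of_compass_eq (h : LabelsSuccessful φ m L)
    (hL : ∀ x j, L x j ⊆ sigmaT φ) {x y x' y' : Fin m} (hxy : x ≤ y) (hxy' : x' ≤ y')
    (heq : compass (labelVal m L) φ x y = compass (labelVal m L) φ x' y') :
    L x y = L x' y' := by
  rw [compass, compass, dif_pos hxy, dif_pos hxy'] at heq
  have key : ∀ ψ ∈ sigmaT φ, (ψ ∈ L x y ↔ ψ ∈ L x' y') := by
    intro ψ hψ
    have h₁ := h.sat_iff_mem hψ ⟨(x, y), hxy⟩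
    have h₂ := h.sat_iff_mem hψ ⟨(x', y'), hxy'⟩
    have h₃ := Set.ext_iff.1 heq ψ
    have hext := sigmaT_subset_extClosure φ hψ
    exact h₁.symm.trans (Iff.trans
      ⟨fun hs => (h₃.1 ⟨hext, hs⟩).2, fun hs => (h₃.2 ⟨hext, hs⟩).2⟩ h₂)
  ext ψ
  exact ⟨fun hψ => (key ψ (hL _ _ hψ)).1 hψ, fun hψ => (key ψ (hL _ _ hψ)).2 hψ⟩

theorem LabelsSuccessful.sim_mem_compass (h : LabelsSuccessful φ m L) {x y : Fin m} :
    Formula.sim ∈ compass (labelVal m L) φ x y ↔ x ≤ y ∧ Formula.sim ∈ L x y := by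
  by_cases hxy : x ≤ y
  · rw [compass, dif_pos hxy, and_iff_right hxy]
    have h₁ := h.sat_iff (sim_mem_closure φ) ⟨(x, y), hxy⟩
    exact ⟨fun hs => h₁.1 hs.2, fun hs => ⟨Or.inl (sim_mem_closure φ), h₁.2 hs⟩⟩
  · simp [compass, hxy]

theorem LabelsSuccessful.exists_rowEmbedding (h : LabelsSuccessful φ m L)
    (hL : ∀ x j, L x j ⊆ sigmaT φ) {y y' : Fin m} (hlt : y < y')
    (hle : CollectionLE (collection (compass (labelVal m L) φ) y)
      (collection (compass (labelVal m L) φ) y')) :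
    ∃ f, RowEmbedding f y (y' - y) L := by
  have hm : 0 < m := (Nat.zero_le _).trans_lt y.isLt
  obtain ⟨r, hr⟩ := ((labelsSuccessful_iff_coherent hm).1 h).sim
  have hclass : ∀ x x', x' ∈ simClass (compass (labelVal m L) φ) x ↔
      r.comap Fin.val x' x := by
    intro x x'
    simp only [simClass, Finset.mem_filter, Finset.mem_univ, true_and, h.sim_mem_compass]
    rw [Setoid.comap_rel]
    constructor
    · rintro (⟨hxx, hs⟩ | ⟨hxx, hs⟩)
      · exact (hr _ _ hxx x.isLt).1 hs
      · exact r.symm ((hr _ _ hxx x'.isLt).1 hs)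
    · intro hrel
      rcases le_total x' x with hxx | hxx
      · exact Or.inl ⟨hxx, (hr _ _ hxx x.isLt).2 hrel⟩
      · exact Or.inr ⟨hxx, (hr _ _ hxx x'.isLt).2 (r.symm hrel)⟩
  obtain ⟨f, hf, hinj, hsim⟩ := exists_injOn_of_collectionLE hclass hle
  have hyd : y.val + (y'.val - y.val) = y'.val := by
    have : y.val < y'.val := hlt
    omega
  let g : ℕ → ℕ := fun x => if hx : x < m then f ⟨x, hx⟩ else 0
  have hg : ∀ x (hx : x ≤ y.val), g x = (f ⟨x, hx.trans_lt y.isLt⟩).val :=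
    fun x hx => dif_pos (hx.trans_lt y.isLt)
  refine ⟨g, ?_, ?_, ?_, ?_⟩
  · intro x hx
    rw [hg x hx, hyd]
    exact (hf ⟨x, _⟩ hx).1
  · intro x hx x' hx' heq
    rw [hg x hx, hg x' hx'] at heq
    exact Fin.val_eq_of_eq (hinj ⟨x, _⟩ hx ⟨x', _⟩ hx' (Fin.ext heq))
  · intro x hx
    rw [hg x hx, hyd]
    have := hf ⟨x, hx.trans_lt y.isLt⟩ hx
    exact h.label_eq_of_compass_eq hL hx this.1 this.2
  · intro x x' hxx' hx'
    have hx := hxx'.trans hx'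
    have hs : r x x' ↔ r (g x) (g x') := by
      rw [hg x hx, hg x' hx']
      exact hsim ⟨x, _⟩ hx ⟨x', _⟩ hx'
    have hgx : g x < m := by rw [hg x hx]; exact Fin.isLt _
    have hgx' : g x' < m := by rw [hg x' hx']; exact Fin.isLt _
    rw [hr x x' hxx' (hx'.trans_lt y.isLt), hs, hr _ _ min_le_max (max_lt hgx hgx')]
    rcases le_total (g x) (g x') with hle | hle
    · rw [min_eq_left hle, max_eq_right hle]
    · rw [min_eq_right hle, max_eq_left hle]
      exact ⟨r.symm, r.symm⟩

end Labels

/-! ### Prefixes that consist of complete rows -/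

section Prefixes

variable {φ : Formula P} {S : Set (Formula P)} {p q : List (Round P)}

theorem IsPlay.visited_of_lt (h : IsPlay φ S p) {x j a c : ℕ} (hv : Visited p x j) (hac : a ≤ c)
    (hcj : c < j) : Visited p a c := by
  obtain ⟨r, hr, rfl, rfl⟩ := hv
  obtain ⟨q, t, rfl⟩ := List.append_of_mem hr
  exact ((h q r ⟨t, by simp⟩).1.2 a c hac hcj).mono (List.prefix_append _ _)

/-- Final rounds are dropped as long as the rows below `b` stay complete. Once the last round is
needed, no round can lie in row `b` or higher: it would have been legal only after those rows were
complete. -/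
theorem IsPlay.exists_isPrefix_visitsRows (h : IsPlay φ S p) {b : ℕ}
    (hv : ∀ x j, x ≤ j → j < b → Visited p x j) : ∃ q, q <+: p ∧ VisitsRows q b := by
  induction p using List.reverseRecOn with
  | nil =>
    exact ⟨[], List.prefix_refl _, fun x j hxj =>
      ⟨fun h => absurd h not_visited_nil, fun h => hv x j hxj h⟩⟩
  | append_singleton p r ih =>
    obtain ⟨hp, hl, -⟩ := isPlay_concat.1 h
    by_cases hall : ∀ x j, x ≤ j → j < b → Visited p x j
    · obtain ⟨q, hq, hqv⟩ := ih hp hall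
      exact ⟨q, hq.trans (List.prefix_append _ _), hqv⟩
    · push Not at hall
      obtain ⟨a, c, hac, hcb, hn⟩ := hall
      refine ⟨_, List.prefix_refl _, fun x j hxj => ⟨fun hxv => ?_, hv x j hxj⟩⟩
      by_contra hj
      rcases visited_concat.1 hxv with hxv | ⟨rfl, rfl⟩
      · exact hn (hp.visited_of_lt hxv hac (by omega))
      · exact hn (hl.2 a c hac (by omega))

theorem label_eq_empty {x j : ℕ} (h : ¬ Visited p x j) : label p x j = ∅ :=
  Set.eq_empty_of_forall_notMem fun _ ⟨r, hr, hrx, _⟩ => h ⟨r, hr, hrx⟩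

theorem VisitsRows.not_visited {b x j : ℕ} (h : VisitsRows p b) (hj : b ≤ j) :
    ¬ Visited p x j := by
  intro hv
  have := (h x j hv.le).1 hv
  omega

/-- The start of the imitation: neither play has reached the rows that `high` compares, so both
sides are empty there. -/
theorem Simulates.of_isPrefix {f : ℕ → ℕ} {y d : ℕ} (h : IsPlay φ S q) (hpq : p <+: q)
    (hp : VisitsRows p (y + 1)) (hq : VisitsRows q (y + d + 1)) :
    Simulates φ S f y d q p q := by
  refine ⟨h.of_prefix hpq, h, List.prefix_refl _, ?_, ?_⟩
  · intro x j hxj hj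
    have hv := (hp x j hxj).2 (by omega)
    exact ⟨hv, (h.label_eq hpq hv).symm⟩
  · intro x j _ hj
    have h₁ := hp.not_visited (x := x) (j := j) (by omega)
    have h₂ := hq.not_visited (x := embed f y d x) (j := j + d) (by omega)
    exact ⟨iff_of_false h₁ h₂, by rw [label_eq_empty h₁, label_eq_empty h₂]⟩

end Prefixes

/-! ### Optimal strategies -/

section Strategy

variable {φ : Formula P} {S : Set (Formula P)} {p q : List (Round P)} {r : Round P}

/-- The least number of rounds in which Duplicator can force a successful run. -/
noncomputable def value (φ : Formula P) (S : Set (Formula P)) (p : List (Round P)) : ℕ :=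
  sInf {n | WinIn φ S n p}

/-- Duplicator can force a successful run. -/
def Winning (φ : Formula P) (S : Set (Formula P)) (p : List (Round P)) : Prop :=
  ∃ n, WinIn φ S n p

theorem Winning.winIn_value (h : Winning φ S p) : WinIn φ S (value φ S p) p :=
  Nat.sInf_mem h

theorem WinIn.value_le {n : ℕ} (h : WinIn φ S n p) : value φ S p ≤ n :=
  Nat.sInf_le h

theorem Winning.exists_answer (h : Winning φ S p) (hs : ¬ IsSuccessful φ S (unroll p))
    {I : NonemptyInterval ℕ} {σ : Set (Formula P)} (hI : Legal p I.fst I.snd) (hσ : σ ⊆ S) :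
    ∃ δ ⊆ sigmaT φ \ S, Winning φ S (p ++ [⟨I, σ, δ⟩]) ∧
      value φ S (p ++ [⟨I, σ, δ⟩]) < value φ S p := by
  have hw := h.winIn_value
  cases hv : value φ S p with
  | zero =>
    rw [hv] at hw
    exact absurd hw hs
  | succ n =>
    rw [hv] at hw
    obtain ⟨δ, hδ, hw'⟩ := hw.resolve_left hs I σ hI hσ
    exact ⟨δ, hδ, ⟨n, hw'⟩, Nat.lt_succ_of_le hw'.value_le⟩

/-- A strategy of Duplicator that decreases the value in each round. -/
def IsOptimal (φ : Formula P) (S : Set (Formula P))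
    (strat : List (Round P) → NonemptyInterval ℕ → Set (Formula P) → Set (Formula P)) : Prop :=
  ∀ p I σ, Winning φ S p → ¬ IsSuccessful φ S (unroll p) → Legal p I.fst I.snd → σ ⊆ S →
    strat p I σ ⊆ sigmaT φ \ S ∧ Winning φ S (p ++ [⟨I, σ, strat p I σ⟩]) ∧
      value φ S (p ++ [⟨I, σ, strat p I σ⟩]) < value φ S p

theorem exists_isOptimal (φ : Formula P) (S : Set (Formula P)) :
    ∃ strat, IsOptimal φ S strat := by
  have : ∀ p I σ, ∃ δ, Winning φ S p → ¬ IsSuccessful φ S (unroll p) →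
      Legal p (NonemptyInterval.toProd I).1 I.toProd.2 → σ ⊆ S →
      δ ⊆ sigmaT φ \ S ∧ Winning φ S (p ++ [⟨I, σ, δ⟩]) ∧
        value φ S (p ++ [⟨I, σ, δ⟩]) < value φ S p := by
    intro p I σ
    by_cases hex : Winning φ S p ∧ ¬ IsSuccessful φ S (unroll p) ∧ Legal p I.fst I.snd ∧ σ ⊆ S
    · obtain ⟨δ, hδ⟩ := hex.1.exists_answer hex.2.1 hex.2.2.1 hex.2.2.2
      exact ⟨δ, fun _ _ _ _ => hδ⟩
    · exact ⟨∅, fun h₁ h₂ h₃ h₄ => absurd ⟨h₁, h₂, h₃, h₄⟩ hex⟩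
  choose strat hstrat using this
  exact ⟨strat, hstrat⟩

/-- The rounds are played with Duplicator's strategy, and not beyond a successful run. -/
def Follows (φ : Formula P) (S : Set (Formula P))
    (strat : List (Round P) → NonemptyInterval ℕ → Set (Formula P) → Set (Formula P))
    (p : List (Round P)) : Prop :=
  ∀ q r, q ++ [r] <+: p → ¬ IsSuccessful φ S (unroll q) ∧
    Legal q r.interval.fst r.interval.snd ∧ r.spoiler ⊆ S ∧
      r.duplicator = strat q r.interval r.spoiler

variable {strat : List (Round P) → NonemptyInterval ℕ → Set (Formula P) → Set (Formula P)}

theorem follows_nil : Follows φ S strat [] := by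
  intro q r h
  simp at h

theorem follows_concat : Follows φ S strat (p ++ [r]) ↔ Follows φ S strat p ∧
    ¬ IsSuccessful φ S (unroll p) ∧ Legal p r.interval.fst r.interval.snd ∧ r.spoiler ⊆ S ∧
      r.duplicator = strat p r.interval r.spoiler := by
  constructor
  · exact fun h => ⟨fun _ _ h' => h _ _ (h'.trans (List.prefix_append _ _)),
      h _ _ (List.prefix_refl _)⟩
  · rintro ⟨h, h'⟩ q t hq
    rcases List.prefix_concat_iff.1 hq with hq | hq
    · obtain ⟨rfl, ht⟩ := List.append_inj' hq rfl
      cases ht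
      exact h'
    · exact h _ _ hq

theorem IsOptimal.concat (h : IsOptimal φ S strat) (hp : Winning φ S p)
    (hf : Follows φ S strat (p ++ [r])) :
    r.duplicator ⊆ sigmaT φ \ S ∧ Winning φ S (p ++ [r]) ∧
      value φ S (p ++ [r]) < value φ S p := by
  obtain ⟨-, hs, hl, hσ, hd⟩ := follows_concat.1 hf
  have := h p r.interval r.spoiler hp hs hl hσ
  rw [← hd] at this
  exact this

theorem Follows.winning_isPlay (hf : Follows φ S strat p) (h : IsOptimal φ S strat)
    (h₀ : Winning φ S []) : Winning φ S p ∧ IsPlay φ S p := by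
  induction p using List.reverseRecOn with
  | nil => exact ⟨h₀, isPlay_nil⟩
  | append_singleton p r ih =>
    obtain ⟨hp, -, hl, hσ, -⟩ := follows_concat.1 hf
    obtain ⟨hw, hplay⟩ := ih hp
    obtain ⟨hd, hw', -⟩ := h.concat hw hf
    exact ⟨hw', isPlay_concat.2 ⟨hplay, hl, hσ, hd⟩⟩

theorem Follows.value_add_le (hf : Follows φ S strat (p ++ q)) (h : IsOptimal φ S strat)
    (h₀ : Winning φ S []) : value φ S (p ++ q) + q.length ≤ value φ S p := by
  induction q using List.reverseRecOn with
  | nil => simp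
  | append_singleton q r ih =>
    rw [← List.append_assoc] at hf
    have hpq := (follows_concat.1 hf).1
    have := (h.concat (hpq.winning_isPlay h h₀).1 hf).2.2
    have := ih hpq
    rw [← List.append_assoc, List.length_append, List.length_singleton]
    omega

/-- The length of a play is bounded by the initial value. Each position has finitely many legal
intervals and finitely many labels for Spoiler, and the strategy fixes the answer. -/
theorem finite_follows (hS : S.Finite) (h : IsOptimal φ S strat) (h₀ : Winning φ S []) :
    {p | Follows φ S strat p}.Finite := by
  have hlen : ∀ n, {p | Follows φ S strat p ∧ p.length = n}.Finite := by
    intro n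
    induction n with
    | zero =>
      refine (Set.finite_singleton []).subset ?_
      rintro p ⟨-, hp⟩
      exact List.eq_nil_of_length_eq_zero hp
    | succ n ih =>
      have hfin := ih.biUnion fun p _ => ((finite_legal p).prod hS.finite_subsets).image
        fun a => p ++ [⟨a.1, a.2, strat p a.1 a.2⟩]
      refine hfin.subset ?_
      rintro p ⟨hf, hp⟩
      induction p using List.reverseRecOn with
      | nil => simp at hp
      | append_singleton p r _ =>
        obtain ⟨hpf, -, hl, hσ, hd⟩ := follows_concat.1 hf
        rw [List.length_append, List.length_singleton, Nat.add_right_cancel_iff] at hp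
        refine Set.mem_biUnion (show p ∈ _ from ⟨hpf, hp⟩) ?_
        refine ⟨(r.interval, r.spoiler), ⟨hl, hσ⟩, ?_⟩
        dsimp only
        rw [← hd]
  refine ((Set.finite_Iic (value φ S [])).biUnion fun n _ => hlen n).subset ?_
  intro p hf
  have hv := Follows.value_add_le (p := []) (q := p) hf h h₀
  exact Set.mem_biUnion (show p.length ∈ Set.Iic (value φ S []) by simp at hv ⊢; omega) ⟨hf, rfl⟩

/-- Comparable rows would make the earlier position at least as fast to win as the later one,
against the strict decrease of the value. -/
theorem Follows.isMinimalCompass (hf : Follows φ S strat p) (hS : S ⊆ sigmaT φ)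
    (h : IsOptimal φ S strat) (h₀ : Winning φ S []) (hs : IsSuccessful φ S (unroll p)) {m : ℕ}
    (hm : (unroll p).length = m * (m + 1)) :
    IsMinimalCompass (compass (inducedVal (unroll p) m) φ) := by
  obtain ⟨-, hplay⟩ := hf.winning_isPlay h h₀
  obtain ⟨m', hm', hv, hc⟩ := hplay.isSuccessful_iff.1 hs
  have hlen := (hplay.isFiniteRun_iff.2 ⟨hm', hv⟩).length_eq
  obtain rfl : m = m' := by
    rw [hlen] at hm
    nlinarith
  rw [inducedVal_unroll]
  intro y y' hlt hle
  obtain ⟨f, hfe⟩ := ((labelsSuccessful_iff_coherent hm').2 hc).exists_rowEmbedding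
    (hplay.label_subset hS) hlt hle
  have hlt' : y.val < y'.val := hlt
  have hylt := y.isLt
  have hylt' := y'.isLt
  generalize y.val = a at *
  obtain ⟨d, hd⟩ : ∃ d, y'.val = a + d := ⟨y'.val - a, by omega⟩
  rw [hd, Nat.add_sub_cancel_left] at hfe
  have hrows : ∀ b ≤ m, ∃ q, q <+: p ∧ VisitsRows q b := fun b hb =>
    hplay.exists_isPrefix_visitsRows fun x j hxj hj => (hv x j hxj).2 (by omega)
  obtain ⟨p₁, hp₁, hv₁⟩ := hrows (a + 1) (by omega)
  obtain ⟨p₂, hp₂, hv₂⟩ := hrows (a + d + 1) (by omega)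
  have hlast : Visited p₂ (a + d) (a + d) := (hv₂ _ _ le_rfl).2 (by omega)
  have hlast' : ¬ Visited p₁ (a + d) (a + d) := hv₁.not_visited (by omega)
  -- Both are prefixes of `p`, and only `p₂` has visited row `a + d`; so at least one round
  -- separates them.
  obtain ⟨q, rfl⟩ : p₁ <+: p₂ :=
    (List.prefix_or_prefix_of_prefix hp₁ hp₂).resolve_right fun h => hlast' (hlast.mono h)
  have hq : q.length ≠ 0 := by
    intro hq
    rw [List.eq_nil_of_length_eq_zero hq, List.append_nil] at hlast
    exact hlast' hlast
  have hf₂ : Follows φ S strat (p₁ ++ q) := fun _ _ h' => hf _ _ (h'.trans hp₂)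
  have hfe₂ : RowEmbedding f a d (label (p₁ ++ q)) := by
    have hlab : ∀ x j, x ≤ j → j ≤ a + d → label p x j = label (p₁ ++ q) x j :=
      fun x j hxj hj => hplay.label_eq hp₂ ((hv₂ x j hxj).2 (by omega))
    refine ⟨hfe.le, hfe.inj, ?_, ?_⟩
    · intro x hx
      rw [← hlab x a hx (by omega), ← hlab _ _ (hfe.le x hx) le_rfl, hfe.label_eq x hx]
    · intro x x' hxx' hx'
      rw [← hlab x x' hxx' (by omega), ← hlab _ _ min_le_max
        (max_le (hfe.le x (hxx'.trans hx')) (hfe.le x' hx')), hfe.sim_iff x x' hxx' hx']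
  obtain ⟨hw₂, hplay₂⟩ := hf₂.winning_isPlay h h₀
  have hw₁ := WinIn.of_simulates hv₂ hfe₂
    (Simulates.of_isPrefix hplay₂ (List.prefix_append _ _) hv₁ hv₂) hw₂.winIn_value
  have := hw₁.value_le
  have := hf₂.value_add_le h h₀
  omega

/-- The strategy is played against `s`; the value decreases, so a successful position is reached. -/
theorem Follows.exists_isSuccessful (hf : Follows φ S strat p) (h : IsOptimal φ S strat)
    (h₀ : Winning φ S []) {s : ℕ → Move P} (hs : IsSpoilerRun φ S s)
    (hp : p.map Round.move = (List.range p.length).map s) :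
    ∃ q, Follows φ S strat q ∧ IsSuccessful φ S (unroll q) ∧
      q.map Round.move = (List.range q.length).map s := by
  induction hn : value φ S p using Nat.strong_induction_on generalizing p with
  | _ n ih =>
    by_cases hsucc : IsSuccessful φ S (unroll p)
    · exact ⟨p, hf, hsucc, hp⟩
    · obtain ⟨hl, hσ⟩ := hs.legal hp
      have hf' : Follows φ S strat
          (p ++ [⟨(s p.length).1, (s p.length).2, strat p (s p.length).1 (s p.length).2⟩]) :=
        follows_concat.2 ⟨hf, hsucc, hl, hσ, rfl⟩
      refine ih _ (hn ▸ (h.concat (hf.winning_isPlay h h₀).1 hf').2.2) hf' ?_ rfl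
      rw [List.length_append, List.length_singleton, List.range_succ, List.map_append,
        List.map_append, hp]
      rfl

end Strategy

/-! ### The tree of positions -/

/-- The nodes of the tree are the positions in the set `R`, and its edges are the rounds. -/
structure IsPositionTree (T : LabelledTree P) (R : Set (List (Round P)))
    (pos : T.V → List (Round P)) : Prop where
  injective : Function.Injective pos
  range_eq : Set.range pos = R
  pos_root : pos T.root = []
  edge_iff : ∀ u v, T.E u v ↔ ∃ r, pos v = pos u ++ [r]
  nodeLabel_root : T.nodeLabel T.root = ∅
  nodeLabel_eq : ∀ v p r, pos v = p ++ [r] → T.nodeLabel v = r.duplicator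
  edgeLabel_eq : ∀ u v p r, pos v = p ++ [r] → T.edgeLabel u v = r.move

theorem exists_isPositionTree {R : Set (List (Round P))} (hfin : R.Finite) (hnil : [] ∈ R)
    (hpre : ∀ p r, p ++ [r] ∈ R → p ∈ R) :
    ∃ (T : LabelledTree P) (pos : T.V → List (Round P)), IsPositionTree T R pos := by
  have := hfin.to_subtype
  -- Positions live in the universe of `P`, but nodes have to form a `Type`; finiteness allows the
  -- move to `Fin`.
  let e := (Finite.equivFin R).symm
  -- At the root the default round is used; its Duplicator part is empty, as `nodeLabel_root`
  -- demands.
  let last : Fin (Nat.card R) → Round P := fun v => (e v).1.getLast?.getD default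
  have hlast : ∀ v p r, (e v).1 = p ++ [r] → last v = r := by
    intro v p r h
    simp only [last, h, List.getLast?_concat, Option.getD_some]
  refine ⟨{ V := Fin (Nat.card R)
            finite := inferInstance
            root := e.symm ⟨[], hnil⟩
            E := fun i j => ∃ r, (e j).1 = (e i).1 ++ [r]
            not_edge_root := ?_
            parent_unique := ?_
            reachable := ?_
            nodeLabel := fun v => (last v).duplicator
            edgeLabel := fun _ v => (last v).move }, fun v => (e v).1, ?_⟩
  · rintro v ⟨r, hr⟩
    rw [Equiv.apply_symm_apply] at hr
    simp at hr
  · rintro u u' v ⟨r, hr⟩ ⟨r', hr'⟩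
    exact e.injective (Subtype.ext (List.append_inj' (hr.symm.trans hr') rfl).1)
  · intro v
    obtain ⟨⟨p, hp⟩, rfl⟩ := e.symm.surjective v
    induction p using List.reverseRecOn with
    | nil => exact Relation.ReflTransGen.refl
    | append_singleton p r ih =>
      exact (ih (hpre p r hp)).tail ⟨r, by rw [e.apply_symm_apply, e.apply_symm_apply]⟩
  · refine ⟨Subtype.val_injective.comp e.injective, ?_, ?_, fun _ _ => Iff.rfl, ?_, ?_, ?_⟩
    · exact (e.surjective.range_comp Subtype.val).trans Subtype.range_val
    · exact congrArg Subtype.val (e.apply_symm_apply _)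
    · change ((e (e.symm ⟨[], hnil⟩)).1.getLast?.getD default).duplicator = ∅
      rw [Equiv.apply_symm_apply]
      rfl
    · exact fun v p r h => congrArg Round.duplicator (hlast v p r h)
    · exact fun _ v p r h => congrArg Round.move (hlast v p r h)

namespace IsPositionTree

variable {T : LabelledTree P} {R : Set (List (Round P))} {pos : T.V → List (Round P)}

theorem mem (h : IsPositionTree T R pos) (v : T.V) : pos v ∈ R :=
  h.range_eq ▸ Set.mem_range_self v

theorem append_rounds (h : IsPositionTree T R pos) {u : T.V} {vs : List T.V}
    (hvs : List.IsChain T.E (u :: vs)) :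
    pos u ++ T.rounds u vs = pos ((u :: vs).getLast (List.cons_ne_nil _ _)) := by
  induction vs generalizing u with
  | nil => exact List.append_nil _
  | cons v vs ih =>
    obtain ⟨huv, hvs⟩ := List.isChain_cons_cons.1 hvs
    obtain ⟨r, hr⟩ := (h.edge_iff u v).1 huv
    rw [LabelledTree.rounds, h.edgeLabel_eq u v _ r hr, h.nodeLabel_eq v _ r hr]
    change pos u ++ r :: _ = _
    rw [List.append_cons, ← hr, ih hvs]
    rfl

theorem rounds_eq (h : IsPositionTree T R pos) {vs : List T.V}
    (hvs : List.IsChain T.E (T.root :: vs)) :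
    T.rounds T.root vs = pos ((T.root :: vs).getLast (List.cons_ne_nil _ _)) := by
  rw [← h.append_rounds hvs, h.pos_root, List.nil_append]

theorem isRootToLeaf_iff (h : IsPositionTree T R pos) {vs : List T.V}
    (hvs : List.IsChain T.E (T.root :: vs)) :
    T.IsRootToLeaf vs ↔ ∀ r, T.rounds T.root vs ++ [r] ∉ R := by
  rw [h.rounds_eq hvs]
  constructor
  · intro hleaf r hr
    rw [← h.range_eq] at hr
    obtain ⟨w, hw⟩ := hr
    exact hleaf.2 w ((h.edge_iff _ _).2 ⟨r, hw⟩)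
  · intro hmax
    refine ⟨hvs, fun w hw => ?_⟩
    obtain ⟨r, hr⟩ := (h.edge_iff _ _).1 hw
    exact hmax r (hr ▸ h.mem w)

theorem exists_rounds_eq (h : IsPositionTree T R pos) (hpre : ∀ p r, p ++ [r] ∈ R → p ∈ R)
    {p : List (Round P)} (hp : p ∈ R) :
    ∃ vs, List.IsChain T.E (T.root :: vs) ∧ T.rounds T.root vs = p := by
  induction p using List.reverseRecOn with
  | nil => exact ⟨[], List.isChain_singleton _, rfl⟩
  | append_singleton p r ih =>
    obtain ⟨vs, hvs, hr⟩ := ih (hpre p r hp)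
    rw [h.rounds_eq hvs] at hr
    rw [← h.range_eq] at hp
    obtain ⟨w, hw⟩ := hp
    have hc := LabelledTree.isChain_concat hvs ((h.edge_iff _ w).2 ⟨r, by rw [hr, hw]⟩)
    refine ⟨_, hc, ?_⟩
    rw [h.rounds_eq hc, ← hw]
    simp

end IsPositionTree

end IntervalSynthesis

open IntervalSynthesis in
theorem mainTheorem7 {P : Type*} (φ : IntervalSynthesis.Formula P)
    (S : Set (IntervalSynthesis.Formula P)) (hS : S ⊆ IntervalSynthesis.sigmaT φ)
    (hT : ∃ T : IntervalSynthesis.LabelledTree P, T.IsResponseTree φ S) :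
    ∃ T' : IntervalSynthesis.LabelledTree P, T'.IsResponseTree φ S ∧ T'.IsMinimal φ := by
  obtain ⟨T, hT⟩ := hT
  have h₀ : Winning φ S [] := ⟨Nat.card T.V,
    hT.winIn _ [] (List.isChain_singleton _) isPlay_nil (Nat.le_add_left _ _)⟩
  obtain ⟨strat, hopt⟩ := exists_isOptimal φ S
  have hpre : ∀ p r, p ++ [r] ∈ {p | Follows φ S strat p} → p ∈ {p | Follows φ S strat p} :=
    fun p r h => (follows_concat.1 h).1
  obtain ⟨T', pos, hpos⟩ := exists_isPositionTree
    (finite_follows ((sigmaT_finite φ).subset hS) hopt h₀) follows_nil hpre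
  -- Leaves are the successful positions: play stops there by definition of `Follows`, and elsewhere
  -- Spoiler always has a legal move.
  have hmax : ∀ p, Follows φ S strat p →
      ((∀ r, ¬ Follows φ S strat (p ++ [r])) ↔ IsSuccessful φ S (unroll p)) := by
    intro p hp
    constructor
    · intro h
      by_contra hs
      obtain ⟨I, hI⟩ := exists_legal p
      exact h ⟨I, ∅, strat p I ∅⟩ (follows_concat.2 ⟨hp, hs, hI, Set.empty_subset _, rfl⟩)
    · exact fun hs r hr => (follows_concat.1 hr).2.1 hs
  have hfollows : ∀ v, Follows φ S strat (pos v) := hpos.mem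
  have hruns : ∀ ρ ∈ T'.runs, ∃ p, Follows φ S strat p ∧
      IsSuccessful φ S (unroll p) ∧ ρ = unroll p := by
    rintro ρ ⟨vs, hvs, rfl⟩
    have hR : Follows φ S strat (T'.rounds T'.root vs) := hpos.rounds_eq hvs.1 ▸ hfollows _
    exact ⟨_, hR, (hmax _ hR).1 ((hpos.isRootToLeaf_iff hvs.1).1 hvs),
      (LabelledTree.unroll_rounds _ _).symm⟩
  have hplay : ∀ v p r, pos v = p ++ [r] → r.spoiler ⊆ S ∧ r.duplicator ⊆ sigmaT φ \ S :=
    fun v p r h => (((hfollows v).winning_isPlay hopt h₀).2 p r (h ▸ List.prefix_refl _)).2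
  refine ⟨T', ⟨?_, ?_, ?_, ?_, ?_⟩, ?_⟩
  · intro v
    rcases List.eq_nil_or_concat (pos v) with h | ⟨p, r, h⟩
    · rw [hpos.injective (h.trans hpos.pos_root.symm), hpos.nodeLabel_root]
      exact Set.empty_subset _
    · rw [List.concat_eq_append] at h
      rw [hpos.nodeLabel_eq v p r h]
      exact (hplay v p r h).2
  · intro u v huv
    obtain ⟨r, hr⟩ := (hpos.edge_iff u v).1 huv
    rw [hpos.edgeLabel_eq u v _ r hr]
    exact (hplay v _ r hr).1
  · intro u v w hv hw heq
    obtain ⟨r, hr⟩ := (hpos.edge_iff u v).1 hv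
    obtain ⟨r', hr'⟩ := (hpos.edge_iff u w).1 hw
    rw [hpos.edgeLabel_eq u v _ r hr, hpos.edgeLabel_eq u w _ r' hr'] at heq
    -- Siblings with the same Spoiler move carry the same answer, since the strategy depends only on
    -- position and move.
    have hd := (follows_concat.1 (hr ▸ hfollows v)).2.2.2.2
    have hd' := (follows_concat.1 (hr' ▸ hfollows w)).2.2.2.2
    refine hpos.injective ?_
    rw [hr, hr']
    obtain ⟨I, σ, δ⟩ := r
    obtain ⟨I', σ', δ'⟩ := r'
    cases heq
    simp only at hd hd'
    rw [hd, hd']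
  · intro ρ hρ
    obtain ⟨p, -, hs, rfl⟩ := hruns ρ hρ
    exact hs
  · intro s hs
    obtain ⟨q, hq, hqs, hmove⟩ := Follows.exists_isSuccessful follows_nil hopt h₀ hs rfl
    obtain ⟨vs, hvs, rfl⟩ := hpos.exists_rounds_eq hpre hq
    refine ⟨vs, (hpos.isRootToLeaf_iff hvs).2 ((hmax _ hq).2 hqs), ?_⟩
    rw [← LabelledTree.map_move_rounds, hmove, LabelledTree.length_rounds]
  · intro ρ hρ m hm
    obtain ⟨p, hp, hs, rfl⟩ := hruns ρ hρ
    exact hp.isMinimalCompass hS hopt h₀ hs hm
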